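/- Let $G$ be a finite acyclic digraph (without loops or parallel edges), whose set of sources (vertices of in-degree $0$) is $S=\{a,b\}$ and whose set of sinks (vertices of out-degree $0$) is $T=\{c,d\}$, where $a\ne b$ and $c\ne d$. Suppose that $S\cap T=\emptyset$, and that every vertex not in $S\cup T$ has in-degree and out-degree both at least two. Then exactly one of the following holds: \begin{itemize} \item there are vertex-disjoint directed paths $P,Q$ of $G$, where $P$ is from $a$ to $c$ and $Q$ is from $b$ to $d$; \item $G$ can be drawn without crossings in a closed disc with $a,b,c,d$ drawn in the boundary in this (cyclic) order. \end{itemize} -/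

import Mathlib

namespace Digraph

variable {V : Type*}

/-- The nonempty list `l` of vertices is a dipath (directed path) of `G` from `u` to `v`:
its vertices are distinct, consecutive ones are joined by edges directed forwards, its first
vertex is `u` and its last vertex is `v`. -/
structure IsDipath (G : Digraph V) (u v : V) (l : List V) : Prop where
  chain : l.IsChain G.Adj
  nodup : l.Nodup
  head_eq : l.head? = some u
  last_eq : l.getLast? = some v

/-- The list `l` is the vertex list of a directed cycle of `G`: it is a dipath, from `u` to `v`
say, and `v` is adjacent to `u`. The case of a single vertex is a loop. -/
def IsDicycle (G : Digraph V) (l : List V) : Prop :=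
  ∃ u v : V, G.IsDipath u v l ∧ G.Adj v u

/-- A digraph is acyclic if it has no directed cycle (in particular, no loop). -/
def IsAcyclic (G : Digraph V) : Prop := ∀ l : List V, ¬ G.IsDicycle l

/-- The set of in-neighbours of a vertex. -/
def inNeighbors (G : Digraph V) (v : V) : Set V := {u | G.Adj u v}

/-- The set of out-neighbours of a vertex. -/
def outNeighbors (G : Digraph V) (v : V) : Set V := {w | G.Adj v w}

/-- The in-degree of a vertex (used for digraphs with finitely many vertices only). -/
noncomputable def inDeg (G : Digraph V) (v : V) : ℕ := (G.inNeighbors v).ncard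

/-- The out-degree of a vertex (used for digraphs with finitely many vertices only). -/
noncomputable def outDeg (G : Digraph V) (v : V) : ℕ := (G.outNeighbors v).ncard

/-- The set of sources: the vertices without in-neighbours. -/
def sources (G : Digraph V) : Set V := {v | G.inNeighbors v = ∅}

/-- The set of sinks: the vertices without out-neighbours. -/
def sinks (G : Digraph V) : Set V := {v | G.outNeighbors v = ∅}

/-- A drawing (without crossings) of `G` in the closed unit disc of the plane `ℂ`. Vertices are
distinct points of the disc, every edge `u → v` is a simple arc in the disc from the point of
`u` to the point of `v`, an arc contains no vertex other than its two ends, and two distinct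
arcs meet in vertices only (hence only in common ends). Arcs and vertices may touch the boundary.
The values of `arc u v` when `u → v` is not an edge are irrelevant. -/
structure DiscDrawing (G : Digraph V) where
  /-- The point representing a vertex. -/
  pos : V → ℂ
  /-- The arc representing an edge. -/
  arc : V → V → C(unitInterval, ℂ)
  pos_mem : ∀ v, pos v ∈ Metric.closedBall (0 : ℂ) 1
  pos_injective : Function.Injective pos
  arc_mem : ∀ u v, G.Adj u v → ∀ t, arc u v t ∈ Metric.closedBall (0 : ℂ) 1
  arc_zero : ∀ u v, G.Adj u v → arc u v 0 = pos u
  arc_one : ∀ u v, G.Adj u v → arc u v 1 = pos v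
  arc_injective : ∀ u v, G.Adj u v → Function.Injective (arc u v)
  arc_vertex : ∀ u v, G.Adj u v → ∀ t w, arc u v t = pos w → w = u ∨ w = v
  arc_inter : ∀ u v u' v', G.Adj u v → G.Adj u' v' → (u, v) ≠ (u', v') →
    ∀ s t, arc u v s = arc u' v' t → ∃ w, arc u v s = pos w

/-- Four points lie on the unit circle in this cyclic (counterclockwise) order, and are distinct:
they have arguments `θ₁ < θ₂ < θ₃ < θ₄ < θ₁ + 2π`. -/
def InOrderOnCircle (p₁ p₂ p₃ p₄ : ℂ) : Prop :=
  ∃ θ₁ θ₂ θ₃ θ₄ : ℝ, θ₁ < θ₂ ∧ θ₂ < θ₃ ∧ θ₃ < θ₄ ∧ θ₄ < θ₁ + 2 * Real.pi ∧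
    p₁ = Complex.exp (θ₁ * Complex.I) ∧ p₂ = Complex.exp (θ₂ * Complex.I) ∧
    p₃ = Complex.exp (θ₃ * Complex.I) ∧ p₄ = Complex.exp (θ₄ * Complex.I)

/-- `G` can be drawn in a closed disc with `a, b, c, d` drawn in the boundary in order.
By scaling, translation and reflection the disc may be taken to be the unit disc and the order
to be counterclockwise. -/
def DrawnInDiscInOrder (G : Digraph V) (a b c d : V) : Prop :=
  ∃ D : G.DiscDrawing, InOrderOnCircle (D.pos a) (D.pos b) (D.pos c) (D.pos d)

/-- There are vertex-disjoint dipaths `P` from `a` to `c` and `Q` from `b` to `d`. -/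
def HasDisjointDipaths (G : Digraph V) (a b c d : V) : Prop :=
  ∃ P Q : List V, G.IsDipath a c P ∧ G.IsDipath b d Q ∧ P.Disjoint Q

end Digraph

/-! Number the vertices along the edges, starting with `a, b` and ending with `c, d`, and move two
tokens from `a, b` along edges, each move going to a vertex later than both tokens. The two traces
are then disjoint. Write `L x y` if the tokens can reach `x, y`, and `R x y` for the same relation
in the reversed digraph, started from `d, c`. In a drawing that rises from `a` (left) and `b`
(right) to `d` (left) and `c` (right), both relations should mean that `x` is left of `y`.

Assume there are no disjoint dipaths. Two pieces (edges or inner vertices) that meet a common level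
cannot have tails ordered one way by `L` and heads the other way by `R`: the forward and backward
walks would combine with the pieces into disjoint dipaths from `a` to `c` and from `b` to `d`
(`no_link`, resting on `PairReach.link`). The degree condition makes `L` and `R` total (`L_total`),
since a vertex can always be pulled back to a neighbour that avoids the other token. Hence any two
distinct pieces on a level are comparable in exactly one way (`lt_total`, `lt_asymm`).

Transitivity is the crux (`not_cyc`). In a cyclic triple, the piece with the earliest head can be
replaced by an edge leaving that head, and the triple stays cyclic. This cannot go on forever, and
it can only stop at coinciding heads, which is contradictory unless all three heads agree; in that
case the reversed digraph is used.

So every level is linearly ordered. Objects get coordinates accordingly, and edges are interpolated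
linearly between consecutive levels. The orders just above one level and just below the next are
consistent (`Fits.consistent`), so edges do not cross, and a square inscribed in the circle carries
the drawing.

Conversely, disjoint dipaths in a drawing would give disjoint paths in the disc joining interlacing
pairs of boundary points. `exists_path_inter` excludes this by a winding number computation for the
difference of the two paths. -/

namespace Digraph

/-! ### Token moves, frames and their symmetries -/

/-- The pairs of vertices that two tokens, initially at `a` and `b`, can reach by moving along
edges, where a token may only move to a vertex later than the one occupied by the other token. -/
inductive PairReach {V : Type*} (adj : V → V → Prop) (ord : V → ℤ) (a b : V) : V → V → Prop
  | base : PairReach adj ord a b a b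
  | left {x y x' : V} : PairReach adj ord a b x y → adj x x' → ord y < ord x' →
      PairReach adj ord a b x' y
  | right {x y y' : V} : PairReach adj ord a b x y → adj y y' → ord x < ord y' →
      PairReach adj ord a b x y'

theorem PairReach.swap {V : Type*} {adj : V → V → Prop} {ord : V → ℤ} {a b x y : V}
    (h : PairReach adj ord a b x y) : PairReach adj ord b a y x := by
  induction h with
  | base => exact .base
  | left _ h1 h2 ih => exact .right ih h1 h2
  | right _ h1 h2 ih => exact .left ih h1 h2

theorem pairReach_swap {V : Type*} {adj : V → V → Prop} {ord : V → ℤ} {a b x y : V} :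
    PairReach adj ord b a y x ↔ PairReach adj ord a b x y :=
  ⟨fun h => h.swap, fun h => h.swap⟩

/-- A piece is an edge, or a degenerate interval at a vertex other than `a, b, c, d`. -/
def IsPiece {V : Type*} (adj : V → V → Prop) (a b c d u w : V) : Prop :=
  adj u w ∨ (u = w ∧ ¬(u = a ∨ u = b) ∧ ¬(u = c ∨ u = d))

/-- A topologically ordered acyclic digraph with sources `a, b` and sinks `c, d`, in which no two
tokens can be moved from `a, b` to `c, d` respectively. -/
structure Frame (V : Type*) where
  adj : V → V → Prop
  ord : V → ℤ
  bound : ℤ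
  (a b c d : V)
  ord_inj : ∀ u v, ord u = ord v → u = v
  ord_bound : ∀ v, -bound ≤ ord v ∧ ord v ≤ bound
  adj_lt : ∀ u v, adj u v → ord u < ord v
  a_ne_b : a ≠ b
  c_ne_d : c ≠ d
  source_sink : ∀ v, (v = a ∨ v = b) → ¬ (v = c ∨ v = d)
  source_lt : ∀ u v, (u = a ∨ u = b) → ¬ (v = a ∨ v = b) → ord u < ord v
  lt_sink : ∀ u v, ¬ (u = c ∨ u = d) → (v = c ∨ v = d) → ord u < ord v
  not_adj_source : ∀ u v, adj u v → ¬ (v = a ∨ v = b)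
  not_sink_adj : ∀ u v, adj u v → ¬ (u = c ∨ u = d)
  in_two : ∀ v, ¬ (v = a ∨ v = b) → ¬ (v = c ∨ v = d) → ∀ z, ∃ u, u ≠ z ∧ adj u v
  out_two : ∀ v, ¬ (v = a ∨ v = b) → ¬ (v = c ∨ v = d) → ∀ z, ∃ w, w ≠ z ∧ adj v w
  noLink : ∀ u w u' w', IsPiece adj a b c d u w → IsPiece adj a b c d u' w' →
    ord u < ord w' → ord u' < ord w → PairReach adj ord a b u u' →
    PairReach (flip adj) (fun v => -ord v) d c w' w → False

namespace Frame

variable {V : Type*} (F : Frame V)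

def Src (v : V) : Prop := v = F.a ∨ v = F.b
def Snk (v : V) : Prop := v = F.c ∨ v = F.d
def Piece (u w : V) : Prop := IsPiece F.adj F.a F.b F.c F.d u w
-- To be thought of as "left of" as seen from below, where `a` is left of `b`.
def L : V → V → Prop := PairReach F.adj F.ord F.a F.b
-- "Left of" as seen from above. The start is `d, c` and not `c, d`, because in the cyclic order `a,
-- b, c, d` the sink above `a` is `d`.
def R : V → V → Prop := PairReach (flip F.adj) (fun v => -F.ord v) F.d F.c

/-- Two pieces are concurrent if some level of the topological order meets both of them. -/
def Conc (u w u' w' : V) : Prop := F.ord u < F.ord w' ∧ F.ord u' < F.ord w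

/-- The left-to-right order of concurrent pieces. -/
def Lt (u w u' w' : V) : Prop := (u ≠ u' → F.L u u') ∧ (w ≠ w' → F.R w w')

theorem isPiece_flip {adj : V → V → Prop} {a b c d u w : V}
    (h : IsPiece (flip adj) d c b a u w) : IsPiece adj a b c d w u := by
  rcases h with h | ⟨rfl, h1, h2⟩
  · exact Or.inl h
  · exact Or.inr ⟨rfl, fun h => h2 h.symm, fun h => h1 h.symm⟩

theorem isPiece_swap {adj : V → V → Prop} {a b c d u w : V}
    (h : IsPiece adj b a d c u w) : IsPiece adj a b c d u w := by
  rcases h with h | ⟨rfl, h1, h2⟩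
  · exact Or.inl h
  · exact Or.inr ⟨rfl, fun h => h1 h.symm, fun h => h2 h.symm⟩

/-- The frame with all edges reversed. -/
def dual : Frame V where
  adj := flip F.adj
  ord := fun v => -F.ord v
  bound := F.bound
  a := F.d
  b := F.c
  c := F.b
  d := F.a
  ord_inj := fun u v h => F.ord_inj u v (by simpa using h)
  ord_bound := fun v => by have := F.ord_bound v; constructor <;> linarith
  adj_lt := fun u v h => by have := F.adj_lt v u h; linarith
  a_ne_b := F.c_ne_d.symm
  c_ne_d := F.a_ne_b.symm
  source_sink := fun v h h' => F.source_sink v h'.symm h.symm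
  source_lt := fun u v h h' => by
    have := F.lt_sink v u (fun h => h' h.symm) h.symm; linarith
  lt_sink := fun u v h h' => by
    have := F.source_lt v u h'.symm (fun h' => h h'.symm); linarith
  not_adj_source := fun u v h h' => F.not_sink_adj v u h h'.symm
  not_sink_adj := fun u v h h' => F.not_adj_source v u h h'.symm
  in_two := fun v h h' => F.out_two v (fun k => h' k.symm) (fun k => h k.symm)
  out_two := fun v h h' => F.in_two v (fun k => h' k.symm) (fun k => h k.symm)
  noLink := fun u w u' w' hp hp' h h' hl hr => by
    simp only [neg_neg] at hr
    exact F.noLink w' u' w u (isPiece_flip hp') (isPiece_flip hp)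
      (by linarith) (by linarith) hr hl

/-- The mirror image of a frame. -/
def mirror : Frame V where
  adj := F.adj
  ord := F.ord
  bound := F.bound
  a := F.b
  b := F.a
  c := F.d
  d := F.c
  ord_inj := F.ord_inj
  ord_bound := F.ord_bound
  adj_lt := F.adj_lt
  a_ne_b := F.a_ne_b.symm
  c_ne_d := F.c_ne_d.symm
  source_sink := fun v h h' => F.source_sink v h.symm h'.symm
  source_lt := fun u v h h' => F.source_lt u v h.symm fun k => h' k.symm
  lt_sink := fun u v h h' => F.lt_sink u v (fun k => h k.symm) h'.symm
  not_adj_source := fun u v h h' => F.not_adj_source u v h h'.symm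
  not_sink_adj := fun u v h h' => F.not_sink_adj u v h h'.symm
  in_two := fun v h h' => F.in_two v (fun k => h k.symm) (fun k => h' k.symm)
  out_two := fun v h h' => F.out_two v (fun k => h k.symm) (fun k => h' k.symm)
  noLink := fun u w u' w' hp hp' h h' hl hr =>
    F.noLink u' w' u w (isPiece_swap hp') (isPiece_swap hp) h' h hl.swap hr.swap

theorem dual_R : F.dual.R = F.L := by
  unfold R L dual
  simp only [neg_neg]
  rfl

theorem dual_piece {u w : V} (h : F.Piece u w) : F.dual.Piece w u :=
  isPiece_flip (adj := flip F.adj) h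

theorem mirror_piece {u w : V} (h : F.Piece u w) : F.mirror.Piece u w := isPiece_swap h

theorem mirror_L {u w : V} : F.mirror.L u w ↔ F.L w u := pairReach_swap

theorem mirror_R {u w : V} : F.mirror.R u w ↔ F.R w u := pairReach_swap

variable {F}

theorem mirror_lt {u w u' w' : V} (h : F.Lt u w u' w') : F.mirror.Lt u' w' u w :=
  ⟨fun hn => F.mirror_L.2 (h.1 hn.symm), fun hn => F.mirror_R.2 (h.2 hn.symm)⟩

theorem dual_lt {u w u' w' : V} (h : F.Lt u w u' w') : F.dual.Lt w u w' u' :=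
  ⟨h.2, by rw [dual_R]; exact h.1⟩

theorem dual_conc {u w u' w' : V} (h : F.Conc u w u' w') : F.dual.Conc w u w' u' := by
  refine ⟨?_, ?_⟩
  · exact neg_lt_neg h.2
  · exact neg_lt_neg h.1

theorem Conc.symm {u w u' w' : V} (h : F.Conc u w u' w') : F.Conc u' w' u w := ⟨h.2, h.1⟩

theorem Piece.not_snk {u w : V} (h : F.Piece u w) : ¬ F.Snk u := by
  rcases h with h | ⟨_, _, h⟩
  · exact F.not_sink_adj _ _ h
  · exact h

theorem Piece.not_src {u w : V} (h : F.Piece u w) : ¬ F.Src w := by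
  rcases h with h | ⟨rfl, h, _⟩
  · exact F.not_adj_source _ _ h
  · exact h

theorem Piece.adj_of_conc {u w w' : V} (h : F.Piece u w) (hc : F.Conc u w u w') : F.adj u w := by
  rcases h with h | ⟨rfl, _, _⟩
  · exact h
  · exact absurd hc.2 (lt_irrefl _)

/-! ### Totality and asymmetry of the left-to-right relations -/

theorem L_ne {x y : V} (h : F.L x y) : x ≠ y := by
  cases h with
  | base => exact F.a_ne_b
  | left _ _ h => rintro rfl; exact lt_irrefl _ h
  | right _ _ h => rintro rfl; exact lt_irrefl _ h

theorem R_ne {x y : V} (h : F.R x y) : x ≠ y := L_ne (F := F.dual) h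

/-- The later of the two vertices is replaced by an in-neighbour different from the other one, which
exists because its in-degree is at least two. The move back to it is legal precisely because it is
the later one. The descent ends when the later vertex is a source, and then both are. -/
theorem L_total (x y : V) (hx : ¬ F.Snk x) (hy : ¬ F.Snk y) (hxy : x ≠ y) :
    F.L x y ∨ F.L y x := by
  have bx := F.ord_bound x
  have bY := F.ord_bound y
  rcases lt_trichotomy (F.ord y) (F.ord x) with h | h | h
  · by_cases hs : F.Src x
    · have hs' : F.Src y := by
        by_contra hs'
        have := F.source_lt x y hs hs'
        omega
      rcases hs with rfl | rfl <;> rcases hs' with rfl | rfl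
      · exact absurd rfl hxy
      · exact Or.inl .base
      · exact Or.inr .base
      · exact absurd rfl hxy
    · obtain ⟨u, hu, hux⟩ := F.in_two x hs hx y
      have h1 := F.adj_lt _ _ hux
      have bu := F.ord_bound u
      rcases L_total u y (F.not_sink_adj _ _ hux) hy hu with h2 | h2
      · exact Or.inl (h2.left hux h)
      · exact Or.inr (h2.right hux h)
  · exact absurd (F.ord_inj _ _ h.symm) hxy
  · by_cases hs : F.Src y
    · have hs' : F.Src x := by
        by_contra hs'
        have := F.source_lt y x hs hs'
        omega
      rcases hs with rfl | rfl <;> rcases hs' with rfl | rfl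
      · exact absurd rfl hxy
      · exact Or.inr .base
      · exact Or.inl .base
      · exact absurd rfl hxy
    · obtain ⟨u, hu, huy⟩ := F.in_two y hs hy x
      have h1 := F.adj_lt _ _ huy
      have bu := F.ord_bound u
      rcases L_total x u hx (F.not_sink_adj _ _ huy) hu.symm with h2 | h2
      · exact Or.inl (h2.right huy h)
      · exact Or.inr (h2.left huy h)
termination_by (2 * F.bound + F.ord x + F.ord y).toNat
decreasing_by all_goals omega

theorem R_total (x y : V) (hx : ¬ F.Src x) (hy : ¬ F.Src y) (hxy : x ≠ y) :
    F.R x y ∨ F.R y x :=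
  L_total (F := F.dual) x y (fun h => hx h.symm) (fun h => hy h.symm) hxy

theorem no_link {u w u' w' : V} (h : F.Piece u w) (h' : F.Piece u' w') (hc : F.Conc u w u' w')
    (hl : F.L u u') (hr : F.R w' w) : False :=
  F.noLink u w u' w' h h' hc.1 hc.2 hl hr

/-- A backward move always ends at a vertex earlier than the other token, so the earlier of the two
vertices is the one that moved last. -/
theorem R_inv_left {x y : V} (h : F.R x y) (hxy : F.ord x < F.ord y) :
    (x = F.d ∧ y = F.c) ∨ ∃ x', F.adj x x' ∧ F.R x' y := by
  cases h with
  | base => exact Or.inl ⟨rfl, rfl⟩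
  | left h1 h2 h3 => exact Or.inr ⟨_, h2, h1⟩
  | right h1 h2 h3 => omega

theorem R_inv_right {x y : V} (h : F.R x y) (hxy : F.ord y < F.ord x) :
    (x = F.d ∧ y = F.c) ∨ ∃ y', F.adj y y' ∧ F.R x y' := by
  cases h with
  | base => exact Or.inl ⟨rfl, rfl⟩
  | left h1 h2 h3 => omega
  | right h1 h2 h3 => exact Or.inr ⟨_, h2, h1⟩

theorem R_snk {x y : V} (h : F.R x y) (hx : F.Snk x) (hy : F.Snk y) : x = F.d ∧ y = F.c := by
  cases h with
  | base => exact ⟨rfl, rfl⟩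
  | left h1 h2 h3 => exact absurd hx (F.not_sink_adj _ _ h2)
  | right h1 h2 h3 => exact absurd hy (F.not_sink_adj _ _ h2)

theorem snk_of_lt {v w : V} (hv : F.Snk v) (h : F.ord v < F.ord w) : F.Snk w := by
  by_contra hw
  have := F.lt_sink w v hw hv
  omega

theorem R_asymm_snk {v w : V} (hv : F.Snk v) (h : F.ord v < F.ord w) (h1 : F.R v w)
    (h2 : F.R w v) : False := by
  have hw := snk_of_lt hv h
  have e1 := R_snk h1 hv hw
  have e2 := R_snk h2 hw hv
  exact F.c_ne_d (e2.2 ▸ e1.1)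

/-- `no_link` says nothing about two edges with a common tail. But `v`, being earlier, was moved
last in both walks, so it has out-edges that `R` places on either side of `w`. Whichever way `L`
orders `u` and `v`, one of these edges conflicts with `u → w`. -/
theorem R_asymm_aux {u v w : V} (huv : F.adj u v) (huw : F.adj u w) (hvw : F.ord v < F.ord w)
    (h1 : F.R v w) (h2 : F.R w v) : False := by
  by_cases hs : F.Snk v
  · exact R_asymm_snk hs hvw h1 h2
  have h3 := R_inv_left h1 hvw
  have h4 := R_inv_right h2 hvw
  obtain ⟨x, hx, hxw⟩ := h3.resolve_left fun h => hs (Or.inr h.1)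
  obtain ⟨y, hy, hwy⟩ := h4.resolve_left fun h => hs (Or.inl h.2)
  have o1 := F.adj_lt _ _ huv
  have o2 := F.adj_lt _ _ hx
  have o3 := F.adj_lt _ _ hy
  rcases L_total u v (F.not_sink_adj _ _ huv) hs (by rintro rfl; omega) with h | h
  · exact no_link (F := F) (Or.inl huw) (Or.inl hx) ⟨by omega, by omega⟩ h hxw
  · exact no_link (F := F) (Or.inl hy) (Or.inl huw) ⟨by omega, by omega⟩ h hwy

theorem R_asymm {u v w : V} (huv : F.adj u v) (huw : F.adj u w)
    (h1 : F.R v w) (h2 : F.R w v) : False := by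
  rcases lt_trichotomy (F.ord v) (F.ord w) with h | h | h
  · exact R_asymm_aux huv huw h h1 h2
  · exact R_ne h1 (F.ord_inj _ _ h)
  · exact R_asymm_aux huw huv h h2 h1

theorem L_asymm {u v w : V} (huv : F.adj u w) (huw : F.adj v w)
    (h1 : F.L u v) (h2 : F.L v u) : False := by
  rw [← dual_R] at h1 h2
  exact R_asymm (F := F.dual) huv huw h1 h2

theorem lt_total {u w u' w' : V} (h : F.Piece u w) (h' : F.Piece u' w') (hc : F.Conc u w u' w')
    (hne : ¬ (u = u' ∧ w = w')) : F.Lt u w u' w' ∨ F.Lt u' w' u w := by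
  by_cases hu : u = u'
  · have hw : w ≠ w' := fun hw => hne ⟨hu, hw⟩
    rcases R_total w w' h.not_src h'.not_src hw with k | k
    · exact Or.inl ⟨fun h => absurd hu h, fun _ => k⟩
    · exact Or.inr ⟨fun h => absurd hu.symm h, fun _ => k⟩
  · rcases L_total u u' h.not_snk h'.not_snk hu with k | k
    · refine Or.inl ⟨fun _ => k, fun hw => ?_⟩
      exact (R_total w w' h.not_src h'.not_src hw).resolve_right (no_link h h' hc k)
    · refine Or.inr ⟨fun _ => k, fun hw => ?_⟩
      exact (R_total w' w h'.not_src h.not_src hw).resolve_right (no_link h' h hc.symm k)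

theorem lt_asymm {u w u' w' : V} (h : F.Piece u w) (h' : F.Piece u' w') (hc : F.Conc u w u' w')
    (hne : ¬ (u = u' ∧ w = w')) (h1 : F.Lt u w u' w') (h2 : F.Lt u' w' u w) : False := by
  by_cases hu : u = u'
  · subst hu
    have hw : w ≠ w' := fun hw => hne ⟨rfl, hw⟩
    exact R_asymm (h.adj_of_conc hc) (h'.adj_of_conc hc.symm) (h1.2 hw) (h2.2 hw.symm)
  · by_cases hw : w = w'
    · subst hw
      have k := (F.dual_piece h).adj_of_conc (dual_conc hc)
      have k' := (F.dual_piece h').adj_of_conc (dual_conc hc).symm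
      exact L_asymm (F := F) (w := w) k k' (h1.1 hu) (h2.1 (Ne.symm hu))
    · exact no_link h h' hc (h1.1 hu) (h2.2 (Ne.symm hw))

/-- A piece ending below the head of another can be shrunk to its head without changing sides.
Otherwise an edge leaving `v` would lie to the right of the other piece, and following it back to
`v` would put `v` right of `w'`. -/
theorem Lt.vertex_left {u v u' w' : V} (hp : F.Piece u v) (hv : ¬ F.Snk v) (hp' : F.Piece u' w')
    (hc : F.Conc u v u' w') (hlt : F.ord v < F.ord w') (h : F.Lt u v u' w') : F.L v u' := by
  refine (L_total v u' hv hp'.not_snk ?_).resolve_right fun hl => ?_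
  · rintro rfl; exact lt_irrefl _ hc.2
  · obtain ⟨x, hxw, hx⟩ := F.out_two v hp.not_src hv w'
    have hvx := F.adj_lt _ _ hx
    have hc2 := hc.2
    have h1 : F.R w' x :=
      (R_total w' x hp'.not_src (F.not_adj_source _ _ hx) hxw.symm).resolve_right
        (no_link (F := F) hp' (Or.inl hx) ⟨by omega, hlt⟩ hl)
    have h2 : F.R w' v := h1.right hx (neg_lt_neg hlt)
    have hvw : v ≠ w' := by rintro rfl; exact lt_irrefl _ hlt
    by_cases hu : u = u'
    · subst hu
      exact R_asymm (hp.adj_of_conc hc) (hp'.adj_of_conc hc.symm) (h.2 hvw) h2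
    · exact no_link hp hp' hc (h.1 hu) h2

theorem Lt.vertex_right {u v u' w' : V} (hp : F.Piece u v) (hv : ¬ F.Snk v) (hp' : F.Piece u' w')
    (hc : F.Conc u v u' w') (hlt : F.ord v < F.ord w') (h : F.Lt u' w' u v) : F.L u' v :=
  F.mirror_L.1 (Lt.vertex_left (F := F.mirror) (F.mirror_piece hp) (fun k => hv k.symm)
    (F.mirror_piece hp') hc hlt (mirror_lt h))

theorem lt_of_L {u w u' w' : V} (h : F.Piece u w) (h' : F.Piece u' w') (hc : F.Conc u w u' w')
    (hl : F.L u u') : F.Lt u w u' w' :=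
  ⟨fun _ => hl, fun hw =>
    (R_total w w' h.not_src h'.not_src hw).resolve_right (no_link h h' hc hl)⟩

/-! ### Absence of cyclic triples -/

/-- Three pairwise concurrent pieces that are cyclically ordered. -/
structure Cyc (F : Frame V) (u₁ w₁ u₂ w₂ u₃ w₃ : V) : Prop where
  p₁ : F.Piece u₁ w₁
  p₂ : F.Piece u₂ w₂
  p₃ : F.Piece u₃ w₃
  c₁₂ : F.Conc u₁ w₁ u₂ w₂
  c₂₃ : F.Conc u₂ w₂ u₃ w₃
  c₃₁ : F.Conc u₃ w₃ u₁ w₁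
  l₁₂ : F.Lt u₁ w₁ u₂ w₂
  l₂₃ : F.Lt u₂ w₂ u₃ w₃
  l₃₁ : F.Lt u₃ w₃ u₁ w₁

theorem Cyc.rot {u₁ w₁ u₂ w₂ u₃ w₃ : V} (h : F.Cyc u₁ w₁ u₂ w₂ u₃ w₃) :
    F.Cyc u₂ w₂ u₃ w₃ u₁ w₁ :=
  ⟨h.p₂, h.p₃, h.p₁, h.c₂₃, h.c₃₁, h.c₁₂, h.l₂₃, h.l₃₁, h.l₁₂⟩

theorem Cyc.dual {u₁ w₁ u₂ w₂ u₃ w₃ : V} (h : F.Cyc u₁ w₁ u₂ w₂ u₃ w₃) :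
    F.dual.Cyc w₁ u₁ w₂ u₂ w₃ u₃ :=
  ⟨F.dual_piece h.p₁, F.dual_piece h.p₂, F.dual_piece h.p₃, dual_conc h.c₁₂, dual_conc h.c₂₃,
    dual_conc h.c₃₁, dual_lt h.l₁₂, dual_lt h.l₂₃, dual_lt h.l₃₁⟩

/-- Shrinking the first two pieces to their common head `w` places `w` on both sides of the third
piece. An edge leaving `w` then contradicts `no_link`. If `w` is a sink, so is `w₃`, and sinks are
ordered only one way. -/
theorem Cyc.false_of_eq {u₁ u₂ u₃ w w₃ : V} (h : F.Cyc u₁ w u₂ w u₃ w₃)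
    (hlt : F.ord w < F.ord w₃) : False := by
  have hne : w ≠ w₃ := by rintro rfl; exact lt_irrefl _ hlt
  by_cases hs : F.Snk w
  · exact R_asymm_snk hs hlt (h.l₂₃.2 hne) (h.l₃₁.2 hne.symm)
  · have h1 := Lt.vertex_left h.p₂ hs h.p₃ h.c₂₃ hlt h.l₂₃
    have h2 := Lt.vertex_right h.p₁ hs h.p₃ h.c₃₁.symm hlt h.l₃₁
    obtain ⟨x, hxw, hx⟩ := F.out_two w h.p₁.not_src hs w₃
    have := F.adj_lt _ _ hx
    have hc := h.c₃₁.1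
    have hp : F.Piece w x := Or.inl hx
    have hcc : F.Conc w x u₃ w₃ := ⟨hlt, by omega⟩
    exact no_link hp h.p₃ hcc h1 ((lt_of_L h.p₃ hp hcc.symm h2).2 hxw.symm)

theorem Cyc.exists_step {u₁ w₁ u₂ w₂ u₃ w₃ : V} (h : F.Cyc u₁ w₁ u₂ w₂ u₃ w₃)
    (h2 : F.ord w₁ < F.ord w₂) (h3 : F.ord w₁ < F.ord w₃) :
    ∃ x, F.ord w₁ < F.ord x ∧ x ≠ w₂ ∧ F.Cyc w₁ x u₂ w₂ u₃ w₃ := by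
  have hne2 : w₁ ≠ w₂ := by rintro rfl; exact lt_irrefl _ h2
  by_cases hs : F.Snk w₁
  · exfalso
    have hne3 : w₁ ≠ w₃ := by rintro rfl; exact lt_irrefl _ h3
    have e1 := R_snk (h.l₁₂.2 hne2) hs (snk_of_lt hs h2)
    have e2 := R_snk (h.l₃₁.2 hne3.symm) (snk_of_lt hs h3) hs
    exact F.c_ne_d (e2.2 ▸ e1.1)
  -- Avoiding `w₂` ensures that the three heads are not all equal after the step.
  · obtain ⟨x, hxw, hx⟩ := F.out_two w₁ h.p₁.not_src hs w₂
    have hlt := F.adj_lt _ _ hx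
    have a1 := h.c₁₂.2
    have a2 := h.c₃₁.1
    have hp : F.Piece w₁ x := Or.inl hx
    have c2 : F.Conc w₁ x u₂ w₂ := ⟨h2, by omega⟩
    have c3 : F.Conc u₃ w₃ w₁ x := ⟨by omega, h3⟩
    refine ⟨x, hlt, hxw, hp, h.p₂, h.p₃, c2, h.c₂₃, c3, ?_, h.l₂₃, ?_⟩
    · exact lt_of_L hp h.p₂ c2 (Lt.vertex_left h.p₁ hs h.p₂ h.c₁₂ h2 h.l₁₂)
    · exact lt_of_L h.p₃ hp c3 (Lt.vertex_right h.p₁ hs h.p₃ h.c₃₁.symm h3 h.l₃₁)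

/-- Each step advances the earliest head, so the bounded sum of the numbers of the heads increases.
When the earliest head is shared by exactly two pieces, `Cyc.false_of_eq` applies after a rotation.
-/
theorem Cyc.false_of_ne {u₁ w₁ u₂ w₂ u₃ w₃ : V} (h : F.Cyc u₁ w₁ u₂ w₂ u₃ w₃)
    (hne : ¬ (w₁ = w₂ ∧ w₂ = w₃)) : False := by
  obtain ⟨n, hn⟩ : ∃ n : ℕ, 3 * F.bound - F.ord w₁ - F.ord w₂ - F.ord w₃ ≤ n :=
    ⟨_, Int.self_le_toNat _⟩
  induction n generalizing u₁ w₁ u₂ w₂ u₃ w₃ with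
  | zero =>
    have b1 := F.ord_bound w₁
    have b2 := F.ord_bound w₂
    have b3 := F.ord_bound w₃
    push_cast at hn
    exact hne ⟨F.ord_inj _ _ (by omega), F.ord_inj _ _ (by omega)⟩
  | succ n ih =>
    push_cast at hn
    have key : ∀ {u₁ w₁ u₂ w₂ u₃ w₃ : V}, F.Cyc u₁ w₁ u₂ w₂ u₃ w₃ →
        3 * F.bound - F.ord w₁ - F.ord w₂ - F.ord w₃ ≤ n + 1 →
        F.ord w₁ ≤ F.ord w₂ → F.ord w₁ ≤ F.ord w₃ → ¬ (w₁ = w₂ ∧ w₂ = w₃) → False := by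
      intro u₁ w₁ u₂ w₂ u₃ w₃ h hn h2 h3 hne
      rcases h2.lt_or_eq with h2 | h2
      · rcases h3.lt_or_eq with h3 | h3
        · obtain ⟨x, hx, hxne, h'⟩ := h.exists_step h2 h3
          exact ih h' (fun k => hxne k.1) (by omega)
        · obtain rfl := F.ord_inj _ _ h3
          exact h.rot.rot.false_of_eq h2
      · obtain rfl := F.ord_inj _ _ h2
        rcases h3.lt_or_eq with h3 | h3
        · exact h.false_of_eq h3
        · exact hne ⟨rfl, F.ord_inj _ _ h3⟩
    rcases le_total (F.ord w₁) (F.ord w₂) with a | a <;>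
      rcases le_total (F.ord w₂) (F.ord w₃) with b | b <;>
      rcases le_total (F.ord w₃) (F.ord w₁) with e | e
    all_goals first
      | exact key h hn (by omega) (by omega) hne
      | exact key h.rot (by omega) (by omega) (by omega) (fun k => hne ⟨k.2 ▸ k.1 ▸ rfl, k.1⟩)
      | exact key h.rot.rot (by omega) (by omega) (by omega)
          (fun k => hne ⟨k.2, k.2 ▸ k.1 ▸ rfl⟩)

/-- If all heads agree, then the tails do not, and these are the heads in the dual frame. -/
theorem not_cyc {u₁ w₁ u₂ w₂ u₃ w₃ : V} (h : F.Cyc u₁ w₁ u₂ w₂ u₃ w₃)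
    (hne : ¬ (u₁ = u₂ ∧ w₁ = w₂)) : False := by
  by_cases hw : w₁ = w₂ ∧ w₂ = w₃
  · exact h.dual.false_of_ne fun hu => hne ⟨hu.1, hw.1⟩
  · exact h.false_of_ne hw

/-! ### Linear order and coordinates on a level -/

variable (F) in
/-- A family of pairwise concurrent pieces. -/
structure IsLevel (O : Set (V × V)) : Prop where
  piece : ∀ o ∈ O, F.Piece o.1 o.2
  conc : ∀ o ∈ O, ∀ o' ∈ O, o ≠ o' → F.Conc o.1 o.2 o'.1 o'.2

theorem IsLevel.lt_total {O : Set (V × V)} (hO : F.IsLevel O) {o o' : V × V} (ho : o ∈ O)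
    (ho' : o' ∈ O) (hne : o ≠ o') : F.Lt o.1 o.2 o'.1 o'.2 ∨ F.Lt o'.1 o'.2 o.1 o.2 :=
  Frame.lt_total (hO.piece o ho) (hO.piece o' ho') (hO.conc o ho o' ho' hne)
    fun h => hne (Prod.ext h.1 h.2)

theorem IsLevel.lt_trans {O : Set (V × V)} (hO : F.IsLevel O) {o₁ o₂ o₃ : V × V} (h₁ : o₁ ∈ O)
    (h₂ : o₂ ∈ O) (h₃ : o₃ ∈ O) (h₁₂ : o₁ ≠ o₂) (h₂₃ : o₂ ≠ o₃)
    (l₁₂ : F.Lt o₁.1 o₁.2 o₂.1 o₂.2) (l₂₃ : F.Lt o₂.1 o₂.2 o₃.1 o₃.2) :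
    o₁ ≠ o₃ ∧ F.Lt o₁.1 o₁.2 o₃.1 o₃.2 := by
  have h₁₃ : o₁ ≠ o₃ := by
    rintro rfl
    exact lt_asymm (hO.piece _ h₁) (hO.piece _ h₂) (hO.conc _ h₁ _ h₂ h₁₂)
      (fun h => h₁₂ (Prod.ext h.1 h.2)) l₁₂ l₂₃
  refine ⟨h₁₃, (hO.lt_total h₁ h₃ h₁₃).resolve_right fun l₃₁ => ?_⟩
  exact not_cyc ⟨hO.piece _ h₁, hO.piece _ h₂, hO.piece _ h₃, hO.conc _ h₁ _ h₂ h₁₂,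
    hO.conc _ h₂ _ h₃ h₂₃, hO.conc _ h₃ _ h₁ h₁₃.symm, l₁₂, l₂₃, l₃₁⟩
    fun h => h₁₂ (Prod.ext h.1 h.2)

theorem IsLevel.exists_coord [Finite V] {O : Set (V × V)} (hO : F.IsLevel O) :
    ∃ X : V × V → ℝ, (∀ o, |X o| ≤ 1) ∧ ∀ o ∈ O, ∀ o' ∈ O, o ≠ o' →
      (F.Lt o.1 o.2 o'.1 o'.2 ∧ X o < X o') ∨ (F.Lt o'.1 o'.2 o.1 o.2 ∧ X o' < X o) := by
  let B : V × V → Set (V × V) := fun o => {p | p ∈ O ∧ p ≠ o ∧ F.Lt p.1 p.2 o.1 o.2}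
  -- The coordinate increases with the number of pieces to the left; the form `1 - 1 / (n + 1)`
  -- keeps it in `[0, 1)` for every count.
  have mono : ∀ o ∈ O, ∀ o' ∈ O, o ≠ o' → F.Lt o.1 o.2 o'.1 o'.2 →
      1 - 1 / (((B o).ncard : ℝ) + 1) < 1 - 1 / (((B o').ncard : ℝ) + 1) := by
    intro o ho o' ho' hne hlt
    have hss : B o ⊂ B o' := by
      refine (Set.ssubset_iff_of_subset ?_).2 ⟨o, ⟨ho, hne, hlt⟩, fun h => h.2.1 rfl⟩
      intro p hp
      exact ⟨hp.1, hO.lt_trans hp.1 ho ho' hp.2.1 hne hp.2.2 hlt⟩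
    have := Set.ncard_lt_ncard hss (Set.toFinite _)
    gcongr
  refine ⟨fun o => 1 - 1 / (((B o).ncard : ℝ) + 1), fun o => ?_, fun o ho o' ho' hne => ?_⟩
  · have h1 : 1 / (((B o).ncard : ℝ) + 1) ≤ 1 := by
      rw [div_le_one (by positivity)]
      have : (0 : ℝ) ≤ (B o).ncard := by positivity
      linarith
    have h2 : 0 ≤ 1 / (((B o).ncard : ℝ) + 1) := by positivity
    rw [abs_le]
    constructor <;> linarith
  · rcases hO.lt_total ho ho' hne with h | h
    · exact Or.inl ⟨h, mono o ho o' ho' hne h⟩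
    · exact Or.inr ⟨h, mono o' ho' o ho hne.symm h⟩

end Frame
end Digraph

/-! ### Interpolation between levels, and the square in the disc -/

namespace Digraph

/-- Piecewise linear interpolation of the values `Z 0, …, Z N`. -/
noncomputable def interp (N : ℤ) (Z : ℤ → ℝ) (s : ℝ) : ℝ :=
  ∑ k ∈ Finset.Icc 0 N, Z k * max 0 (1 - |s - k|)

theorem continuous_interp (N : ℤ) (Z : ℤ → ℝ) : Continuous (interp N Z) := by
  unfold interp
  fun_prop

theorem interp_int {N k : ℤ} (Z : ℤ → ℝ) (h0 : 0 ≤ k) (hN : k ≤ N) : interp N Z k = Z k := by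
  unfold interp
  rw [Finset.sum_eq_single k]
  · simp
  · intro j _ hjk
    have h1 : (1 : ℝ) ≤ |(k : ℝ) - j| := by
      have : (1 : ℤ) ≤ |k - j| := Int.one_le_abs (by omega)
      exact_mod_cast this
    rw [max_eq_left (by linarith), mul_zero]
  · intro h
    exact absurd (Finset.mem_Icc.2 ⟨h0, hN⟩) h

theorem interp_between {N k : ℤ} (Z : ℤ → ℝ) {s : ℝ} (h0 : 0 ≤ k) (hN : k + 1 ≤ N)
    (h1 : (k : ℝ) ≤ s) (h2 : s ≤ k + 1) :
    interp N Z s = (k + 1 - s) * Z k + (s - k) * Z (k + 1) := by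
  unfold interp
  have hsub : ({k, k + 1} : Finset ℤ) ⊆ Finset.Icc 0 N := by
    intro j hj
    simp only [Finset.mem_insert, Finset.mem_singleton] at hj
    rw [Finset.mem_Icc]
    omega
  rw [← Finset.sum_subset hsub, Finset.sum_pair (by omega)]
  · have e1 : |s - (k : ℝ)| = s - k := abs_of_nonneg (by linarith)
    have e2 : |s - ((k + 1 : ℤ) : ℝ)| = k + 1 - s := by
      push_cast
      rw [abs_of_nonpos (by linarith)]
      ring
    rw [e1, e2, max_eq_right (by linarith), max_eq_right (by linarith)]
    ring
  · intro j _ hj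
    simp only [Finset.mem_insert, Finset.mem_singleton, not_or] at hj
    have : j + 1 ≤ k ∨ k + 2 ≤ j := by omega
    have h3 : (1 : ℝ) ≤ |s - j| := by
      rcases this with h | h
      · have : (j : ℝ) + 1 ≤ k := by exact_mod_cast h
        exact le_trans (by linarith) (le_abs_self _)
      · have : (k : ℝ) + 2 ≤ j := by exact_mod_cast h
        exact le_trans (by linarith) (neg_le_abs _)
    rw [max_eq_left (by linarith), mul_zero]

/-- The point of the square inscribed in the unit circle with coordinates `x ∈ [-1, 1]` and
`y ∈ [0, N]`. -/
noncomputable def squarePoint (N : ℤ) (x y : ℝ) : ℂ :=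
  ⟨√2 / 2 * x, √2 / 2 * (2 * y / N - 1)⟩

theorem squarePoint_inj {N : ℤ} (hN : 0 < N) {x y x' y' : ℝ}
    (h : squarePoint N x y = squarePoint N x' y') : x = x' ∧ y = y' := by
  have hN' : (0 : ℝ) < N := by exact_mod_cast hN
  have h2 : (√2 / 2 : ℝ) ≠ 0 := by positivity
  have h1 := congrArg Complex.re h
  have h3 := congrArg Complex.im h
  simp only [squarePoint] at h1 h3
  refine ⟨mul_left_cancel₀ h2 h1, ?_⟩
  have h4 := mul_left_cancel₀ h2 h3
  field_simp at h4
  linarith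

theorem squarePoint_mem {N : ℤ} (hN : 0 < N) {x y : ℝ} (hx : |x| ≤ 1) (h0 : 0 ≤ y) (h1 : y ≤ N) :
    squarePoint N x y ∈ Metric.closedBall (0 : ℂ) 1 := by
  have hN' : (0 : ℝ) < N := by exact_mod_cast hN
  have hy : |2 * y / N - 1| ≤ 1 := by
    have : 2 * y / N ≤ 2 := by rw [div_le_iff₀ hN']; linarith
    have : 0 ≤ 2 * y / N := by positivity
    rw [abs_le]; constructor <;> linarith
  rw [mem_closedBall_zero_iff, ← abs_of_nonneg (norm_nonneg _), ← sq_le_one_iff_abs_le_one,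
    ← Complex.normSq_eq_norm_sq, Complex.normSq_apply]
  simp only [squarePoint]
  have h2 : √2 * √2 = 2 := Real.mul_self_sqrt (by norm_num)
  have hx2 := (sq_le_one_iff_abs_le_one x).2 hx
  have hy2 := (sq_le_one_iff_abs_le_one _).2 hy
  calc _ = (√2 * √2) / 4 * (x ^ 2 + (2 * y / N - 1) ^ 2) := by ring
    _ ≤ 1 := by rw [h2]; linarith

theorem squarePoint_corner {N : ℤ} {x y : ℝ} {θ : ℝ} (hx : √2 / 2 * x = Real.cos θ)
    (hy : √2 / 2 * (2 * y / N - 1) = Real.sin θ) : 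
    squarePoint N x y = Complex.exp (θ * Complex.I) := by
  apply Complex.ext
  · rw [Complex.exp_ofReal_mul_I_re]; exact hx
  · rw [Complex.exp_ofReal_mul_I_im]; exact hy

theorem squarePoint_inOrder {N : ℤ} (hN : 0 < N) : InOrderOnCircle (squarePoint N (-1) 0)
    (squarePoint N 1 0) (squarePoint N 1 N) (squarePoint N (-1) N) := by
  have hN' : (N : ℝ) ≠ 0 := by exact_mod_cast hN.ne'
  have hpi := Real.pi_pos
  -- The corners have arguments 5π/4, 7π/4, 9π/4 and 11π/4, counterclockwise from the lower left.
  refine ⟨Real.pi / 4 + Real.pi, -(Real.pi / 4) + 2 * Real.pi, Real.pi / 4 + 2 * Real.pi,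
    Real.pi - Real.pi / 4 + 2 * Real.pi, by linarith, by linarith, by linarith, by linarith,
    squarePoint_corner ?_ ?_, squarePoint_corner ?_ ?_, squarePoint_corner ?_ ?_,
    squarePoint_corner ?_ ?_⟩
  all_goals
    simp only [Real.cos_add_pi, Real.sin_add_pi, Real.cos_add_two_pi, Real.sin_add_two_pi,
      Real.cos_neg, Real.sin_neg, Real.cos_pi_sub, Real.sin_pi_sub, Real.cos_pi_div_four,
      Real.sin_pi_div_four]
    try field_simp
    try norm_num

/-! ### Heights, coordinates and the drawing -/

namespace Frame

variable {V : Type*} (F : Frame V) (N : ℤ)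

open Classical in
/-- The height of a vertex in the drawing. -/
noncomputable def height (v : V) : ℤ := if F.Src v then 0 else if F.Snk v then N else F.ord v

/-- The frame has all its vertices other than `a, b, c, d` strictly between the levels
`0` and `N`. -/
structure Fits : Prop where
  pos : 0 < N
  inner : ∀ v, ¬ F.Src v → ¬ F.Snk v → 0 < F.ord v ∧ F.ord v < N

variable {F N}

theorem height_src {v : V} (h : F.Src v) : F.height N v = 0 := if_pos h

theorem height_snk {v : V} (h : F.Snk v) : F.height N v = N := by
  rw [height, if_neg (show ¬ F.Src v from fun h' => F.source_sink v h' h), if_pos h]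

theorem height_inner {v : V} (h : ¬ F.Src v) (h' : ¬ F.Snk v) : F.height N v = F.ord v := by
  rw [height, if_neg h, if_neg h']

theorem Fits.height_mem (hF : F.Fits N) (v : V) : 0 ≤ F.height N v ∧ F.height N v ≤ N := by
  have := hF.pos
  by_cases h : F.Src v
  · rw [height_src h]; omega
  · by_cases h' : F.Snk v
    · rw [height_snk h']; omega
    · rw [height_inner h h']
      have := hF.inner v h h'
      omega

theorem Fits.src_of_height (hF : F.Fits N) {v : V} (h : F.height N v = 0) : F.Src v := by
  by_contra hs
  have := hF.pos
  by_cases h' : F.Snk v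
  · rw [height_snk h'] at h; omega
  · rw [height_inner hs h'] at h
    have := hF.inner v hs h'
    omega

theorem Fits.snk_of_height (hF : F.Fits N) {v : V} (h : F.height N v = N) : F.Snk v := by
  by_contra hs
  have := hF.pos
  by_cases h' : F.Src v
  · rw [height_src h'] at h; omega
  · rw [height_inner h' hs] at h
    have := hF.inner v h' hs
    omega

theorem Fits.ord_lt (hF : F.Fits N) {u v : V} (h : F.height N u < F.height N v) :
    F.ord u < F.ord v := by
  have hu := hF.height_mem u
  have hv := hF.height_mem v
  have hv' : ¬ F.Src v := fun k => by rw [height_src k] at h; omega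
  have hu' : ¬ F.Snk u := fun k => by rw [height_snk k] at h; omega
  by_cases h1 : F.Src u
  · exact F.source_lt u v h1 hv'
  by_cases h2 : F.Snk v
  · exact F.lt_sink u v hu' h2
  · rwa [height_inner h1 hu', height_inner hv' h2] at h

theorem Fits.height_lt (hF : F.Fits N) {u v : V} (h : F.adj u v) :
    F.height N u < F.height N v := by
  have hv' : ¬ F.Src v := F.not_adj_source _ _ h
  have hu' : ¬ F.Snk u := F.not_sink_adj _ _ h
  have hu := hF.height_mem u
  have hv := hF.height_mem v
  by_contra hlt
  by_cases h1 : F.Src u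
  · exact hv' (hF.src_of_height (by rw [height_src h1] at hlt; omega))
  by_cases h2 : F.Snk v
  · exact hu' (hF.snk_of_height (by rw [height_snk h2] at hlt; omega))
  · rw [height_inner h1 hu', height_inner hv' h2] at hlt
    exact hlt (F.adj_lt _ _ h)

variable (F N) in
/-- The vertices of height `h`, and the edges passing level `h`. -/
def objects (h : ℤ) : Set (V × V) :=
  {o | (F.adj o.1 o.2 ∧ F.height N o.1 < h ∧ h < F.height N o.2) ∨
    (o.1 = o.2 ∧ F.height N o.1 = h)}

theorem Fits.isLevel (hF : F.Fits N) {h : ℤ} (h0 : 0 < h) (hN : h < N) :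
    F.IsLevel (F.objects N h) := by
  constructor
  · rintro ⟨u, w⟩ (⟨ha, _⟩ | ⟨he, hh⟩)
    · exact Or.inl ha
    · refine Or.inr ⟨he, fun hs => ?_, fun hs => ?_⟩
      · have := height_src (N := N) (F := F) hs; omega
      · have := height_snk (N := N) (F := F) hs; omega
  · rintro ⟨u, w⟩ (⟨_, h1, h2⟩ | ⟨he, hh⟩) ⟨u', w'⟩ (⟨_, h1', h2'⟩ | ⟨he', hh'⟩) hne <;>
      dsimp only at *
    · exact ⟨hF.ord_lt (by omega), hF.ord_lt (by omega)⟩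
    · subst he'
      exact ⟨hF.ord_lt (by omega), hF.ord_lt (by omega)⟩
    · subst he
      exact ⟨hF.ord_lt (by omega), hF.ord_lt (by omega)⟩
    · subst he he'
      exfalso
      apply hne
      have key : ∀ v : V, F.height N v = h → F.ord v = h := by
        intro v hv
        rw [← hv, height_inner]
        · intro k; rw [height_src k] at hv; omega
        · intro k; rw [height_snk k] at hv; omega
      rw [F.ord_inj u u' (by rw [key u hh, key u' hh'])]

variable (F) in
/-- The relation between two pieces, one to the left of the other, just above a level. -/
def LeftAbove (o o' : V × V) : Prop :=
  (o.1 ≠ o'.1 → F.L o.1 o'.1) ∧ (o.1 = o'.1 → F.R o.2 o'.2)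

variable (F) in
/-- The relation between two pieces, one to the left of the other, just below a level. -/
def LeftBelow (o o' : V × V) : Prop :=
  (o.2 ≠ o'.2 → F.R o.2 o'.2) ∧ (o.2 = o'.2 → F.L o.1 o'.1)

variable (F N) in
/-- Coordinates for the objects of level `h`. -/
structure IsCoord (h : ℤ) (X : V × V → ℝ) : Prop where
  abs_le : ∀ o, |X o| ≤ 1
  compare : ∀ o ∈ F.objects N h, ∀ o' ∈ F.objects N h, o ≠ o' →
    (X o < X o' ∧ (h < N → F.LeftAbove o o') ∧ (0 < h → F.LeftBelow o o')) ∨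
    (X o' < X o ∧ (h < N → F.LeftAbove o' o) ∧ (0 < h → F.LeftBelow o' o))

theorem Lt.leftAbove {o o' : V × V} (hne : o ≠ o') (h : F.Lt o.1 o.2 o'.1 o'.2) :
    F.LeftAbove o o' :=
  ⟨h.1, fun he => h.2 fun k => hne (Prod.ext he k)⟩

theorem Lt.leftBelow {o o' : V × V} (hne : o ≠ o') (h : F.Lt o.1 o.2 o'.1 o'.2) :
    F.LeftBelow o o' :=
  ⟨h.2, fun he => h.1 fun k => hne (Prod.ext k he)⟩

theorem Fits.exists_isCoord [Finite V] (hF : F.Fits N) {h : ℤ} (h0 : 0 < h) (hN : h < N) :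
    ∃ X, F.IsCoord N h X := by
  obtain ⟨X, hX, hX'⟩ := (hF.isLevel h0 hN).exists_coord
  refine ⟨X, hX, fun o ho o' ho' hne => ?_⟩
  rcases hX' o ho o' ho' hne with ⟨h1, h2⟩ | ⟨h1, h2⟩
  · exact Or.inl ⟨h2, fun _ => h1.leftAbove hne, fun _ => h1.leftBelow hne⟩
  · exact Or.inr ⟨h2, fun _ => h1.leftAbove hne.symm, fun _ => h1.leftBelow hne.symm⟩

open Classical in
variable (F N) in
/-- Coordinates for all levels: the sources and sinks are put at the ends of their levels. -/
noncomputable def coord (h : ℤ) : V × V → ℝ :=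
  if h = 0 then fun o => if o.1 = F.a then -1 else 1
  else if h = N then fun o => if o.1 = F.d then -1 else 1
  else if hX : ∃ X, F.IsCoord N h X then hX.choose else 0

theorem Fits.coord_a : F.coord N 0 (F.a, F.a) = -1 := by simp [coord]

theorem Fits.coord_b : F.coord N 0 (F.b, F.b) = 1 := by simp [coord, F.a_ne_b.symm]

theorem Fits.coord_d (hF : F.Fits N) : F.coord N N (F.d, F.d) = -1 := by
  simp [coord, hF.pos.ne']

theorem Fits.coord_c (hF : F.Fits N) : F.coord N N (F.c, F.c) = 1 := by
  simp [coord, hF.pos.ne', F.c_ne_d]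

/-- The bottom and top levels consist of the sources and of the sinks alone, and their orders are
the starting positions of `L` and of `R`. Only one side of each of these levels matters, hence the
guards `h < N` and `0 < h` in `IsCoord`. -/
theorem Fits.isCoord [Finite V] (hF : F.Fits N) {h : ℤ} (h0 : 0 ≤ h) (hN : h ≤ N) :
    F.IsCoord N h (F.coord N h) := by
  have hp := hF.pos
  rcases eq_or_ne h 0 with rfl | hh0
  · constructor
    · intro o
      simp only [coord, if_true]
      split_ifs <;> simp
    · have key : ∀ o ∈ F.objects N 0, o = (F.a, F.a) ∨ o = (F.b, F.b) := by
        rintro ⟨u, w⟩ (⟨_, h1, _⟩ | ⟨he, h1⟩) <;> dsimp only at *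
        · have := hF.height_mem u; omega
        · subst he
          rcases hF.src_of_height h1 with rfl | rfl
          · exact Or.inl rfl
          · exact Or.inr rfl
      have hab : F.LeftAbove (F.a, F.a) (F.b, F.b) :=
        ⟨fun _ => .base, fun h => absurd h F.a_ne_b⟩
      intro o ho o' ho' hne
      rcases key o ho with rfl | rfl <;> rcases key o' ho' with rfl | rfl
      · exact absurd rfl hne
      · exact Or.inl ⟨by rw [coord_a, coord_b]; norm_num, fun _ => hab, fun h => absurd h (lt_irrefl _)⟩
      · exact Or.inr ⟨by rw [coord_a, coord_b]; norm_num, fun _ => hab, fun h => absurd h (lt_irrefl _)⟩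
      · exact absurd rfl hne
  rcases eq_or_ne h N with rfl | hhN
  · constructor
    · intro o
      simp only [coord, if_true, if_neg hh0]
      split_ifs <;> simp
    · have key : ∀ o ∈ F.objects h h, o = (F.d, F.d) ∨ o = (F.c, F.c) := by
        rintro ⟨u, w⟩ (⟨_, _, h1⟩ | ⟨he, h1⟩) <;> dsimp only at *
        · have := hF.height_mem w; omega
        · subst he
          rcases hF.snk_of_height h1 with rfl | rfl
          · exact Or.inr rfl
          · exact Or.inl rfl
      have hdc : F.LeftBelow (F.d, F.d) (F.c, F.c) :=
        ⟨fun _ => .base, fun h => absurd h F.c_ne_d.symm⟩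
      intro o ho o' ho' hne
      rcases key o ho with rfl | rfl <;> rcases key o' ho' with rfl | rfl
      · exact absurd rfl hne
      · exact Or.inl ⟨by rw [hF.coord_c, hF.coord_d]; norm_num, fun h => absurd h (lt_irrefl _), fun _ => hdc⟩
      · exact Or.inr ⟨by rw [hF.coord_c, hF.coord_d]; norm_num, fun h => absurd h (lt_irrefl _), fun _ => hdc⟩
      · exact absurd rfl hne
  · have hX := hF.exists_isCoord (h := h) (by omega) (by omega)
    rw [coord, if_neg hh0, if_neg hhN, dif_pos hX]
    exact hX.choose_spec

theorem IsCoord.inj {h : ℤ} {X : V × V → ℝ} (hX : F.IsCoord N h X) {o o' : V × V}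
    (ho : o ∈ F.objects N h) (ho' : o' ∈ F.objects N h) (he : X o = X o') : o = o' := by
  by_contra hne
  rcases hX.compare o ho o' ho' hne with k | k
  · exact absurd he k.1.ne
  · exact absurd he k.1.ne'

theorem IsCoord.of_lt {h : ℤ} {X : V × V → ℝ} (hX : F.IsCoord N h X) {o o' : V × V}
    (ho : o ∈ F.objects N h) (ho' : o' ∈ F.objects N h) (hlt : X o < X o') :
    (h < N → F.LeftAbove o o') ∧ (0 < h → F.LeftBelow o o') := by
  have hne : o ≠ o' := by rintro rfl; exact lt_irrefl _ hlt
  rcases hX.compare o ho o' ho' hne with k | k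
  · exact k.2
  · exact absurd hlt k.1.not_gt

open Classical in
variable (F N) in
/-- The object of level `h` that the edge `u → w` belongs to. -/
noncomputable def objectAt (u w : V) (h : ℤ) : V × V :=
  if F.height N u = h then (u, u) else if F.height N w = h then (w, w) else (u, w)

theorem objectAt_mem {u w : V} (ha : F.adj u w) {h : ℤ} (h1 : F.height N u ≤ h)
    (h2 : h ≤ F.height N w) : F.objectAt N u w h ∈ F.objects N h := by
  unfold objectAt
  split_ifs with k1 k2
  · exact Or.inr ⟨rfl, k1⟩
  · exact Or.inr ⟨rfl, k2⟩
  · exact Or.inl ⟨ha, lt_of_le_of_ne h1 k1, lt_of_le_of_ne h2 (Ne.symm k2)⟩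

theorem objectAt_low {u w : V} {h : ℤ} (h2 : h < F.height N w) :
    (F.objectAt N u w h = (u, u) ∧ F.height N u = h) ∨
      (F.objectAt N u w h = (u, w) ∧ F.height N u ≠ h) := by
  unfold objectAt
  split_ifs with k1 k2
  · exact Or.inl ⟨rfl, k1⟩
  · omega
  · exact Or.inr ⟨rfl, k1⟩

theorem objectAt_high {u w : V} {h : ℤ} (h2 : F.height N u < h) :
    (F.objectAt N u w h = (w, w) ∧ F.height N w = h) ∨
      (F.objectAt N u w h = (u, w) ∧ F.height N w ≠ h) := by
  unfold objectAt
  split_ifs with k1 k2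
  · omega
  · exact Or.inl ⟨rfl, k2⟩
  · exact Or.inr ⟨rfl, k2⟩

/-- An edge starting on the level is represented there by its tail. Distinct tails are compared by
`L` either way; equal tails have equal height, so both edges are represented in the same manner. -/
theorem above_of_low {u w u' w' : V} {h : ℤ} (h2 : h < F.height N w) (h2' : h < F.height N w')
    (hl : F.LeftAbove (F.objectAt N u w h) (F.objectAt N u' w' h)) :
    F.LeftAbove (u, w) (u', w') := by
  rcases objectAt_low (F := F) (u := u) h2 with ⟨e, k⟩ | ⟨e, k⟩ <;>
    rcases objectAt_low (F := F) (u := u') h2' with ⟨e', k'⟩ | ⟨e', k'⟩ <;> rw [e, e'] at hl <;>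
    refine ⟨hl.1, fun he => ?_⟩ <;> dsimp only at he <;> subst he
  · exact absurd rfl (R_ne (hl.2 rfl))
  · exact absurd k k'
  · exact absurd k' k
  · exact hl.2 rfl

theorem below_of_high {u w u' w' : V} {h : ℤ} (h2 : F.height N u < h) (h2' : F.height N u' < h)
    (hl : F.LeftBelow (F.objectAt N u w h) (F.objectAt N u' w' h)) :
    F.LeftBelow (u, w) (u', w') := by
  rcases objectAt_high (F := F) (w := w) h2 with ⟨e, k⟩ | ⟨e, k⟩ <;>
    rcases objectAt_high (F := F) (w := w') h2' with ⟨e', k'⟩ | ⟨e', k'⟩ <;> rw [e, e'] at hl <;>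
    refine ⟨hl.1, fun he => ?_⟩ <;> dsimp only at he <;> subst he
  · exact absurd rfl (L_ne (hl.2 rfl))
  · exact absurd k k'
  · exact absurd k' k
  · exact hl.2 rfl

/-- The left-to-right orders just above a level and just below the next one are consistent. -/
theorem Fits.consistent (hF : F.Fits N) {u w u' w' : V} {h : ℤ} (ha : F.adj u w)
    (ha' : F.adj u' w') (h1 : F.height N u ≤ h) (h1' : F.height N u' ≤ h)
    (h2 : h < F.height N w) (h2' : h < F.height N w')
    (hl : F.LeftAbove (u, w) (u', w')) (hr : F.LeftBelow (u', w') (u, w)) : False := by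
  by_cases hu : u = u'
  · subst hu
    have k := hl.2 rfl
    exact R_asymm ha ha' k (hr.1 (R_ne k).symm)
  · by_cases hw : w = w'
    · subst hw
      exact L_asymm ha ha' (hl.1 hu) (hr.2 rfl)
    · exact no_link (F := F) (Or.inl ha) (Or.inl ha')
        ⟨hF.ord_lt (by omega), hF.ord_lt (by omega)⟩ (hl.1 hu) (hr.1 (Ne.symm hw))

variable (F N) in
/-- The horizontal coordinate of the edge `u → w` at height `s`. -/
noncomputable def edgeCoord (u w : V) (s : ℝ) : ℝ :=
  interp N (fun h => F.coord N h (F.objectAt N u w h)) s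

theorem exists_int_or_between {N : ℤ} {s : ℝ} (h0 : 0 ≤ s) (h1 : s ≤ N) :
    (∃ k : ℤ, s = k ∧ 0 ≤ k ∧ k ≤ N) ∨ ∃ k : ℤ, (k : ℝ) < s ∧ s < k + 1 ∧ 0 ≤ k ∧ k + 1 ≤ N := by
  have k0 : 0 ≤ ⌊s⌋ := Int.floor_nonneg.2 h0
  rcases (Int.floor_le s).lt_or_eq with h | h
  · refine Or.inr ⟨⌊s⌋, h, Int.lt_floor_add_one s, k0, ?_⟩
    have : (⌊s⌋ : ℝ) < N := lt_of_lt_of_le h h1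
    have : ⌊s⌋ < N := by exact_mod_cast this
    omega
  · refine Or.inl ⟨⌊s⌋, h.symm, k0, ?_⟩
    rw [← h] at h1
    exact_mod_cast h1

theorem Fits.abs_edgeCoord_le [Finite V] (hF : F.Fits N) (u w : V) {s : ℝ} (h0 : 0 ≤ s)
    (h1 : s ≤ N) : |F.edgeCoord N u w s| ≤ 1 := by
  unfold edgeCoord
  rcases exists_int_or_between h0 h1 with ⟨k, rfl, k0, k1⟩ | ⟨k, hk, hk', k0, k1⟩
  · rw [interp_int _ k0 k1]
    exact (hF.isCoord k0 k1).abs_le _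
  · rw [interp_between _ k0 k1 hk.le hk'.le]
    have b1 := abs_le.1 ((hF.isCoord k0 (by omega)).abs_le (F.objectAt N u w k))
    have b2 := abs_le.1 ((hF.isCoord (by omega : 0 ≤ k + 1) k1).abs_le (F.objectAt N u w (k + 1)))
    rw [abs_le]
    constructor <;> nlinarith

theorem Fits.vertex_on_edge [Finite V] (hF : F.Fits N) {u w v : V} (ha : F.adj u w)
    (h1 : F.height N u ≤ F.height N v) (h2 : F.height N v ≤ F.height N w)
    (he : F.edgeCoord N u w (F.height N v) = F.coord N (F.height N v) (v, v)) :
    v = u ∨ v = w := by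
  have hv := hF.height_mem v
  rw [edgeCoord, interp_int _ hv.1 hv.2] at he
  have := (hF.isCoord hv.1 hv.2).inj (objectAt_mem ha h1 h2) (Or.inr ⟨rfl, rfl⟩) he
  unfold objectAt at this
  split_ifs at this
  · exact Or.inl (congrArg Prod.fst this).symm
  · exact Or.inr (congrArg Prod.fst this).symm
  · exact Or.inl (congrArg Prod.fst this).symm

/-- On an integer level, equal coordinates mean equal objects, and distinct edges share only
vertices. Between levels both edges are segments, so a meeting point either reverses their strict
order, against `Fits.consistent`, or makes them agree at both ends. -/
theorem Fits.edges_meet [Finite V] (hF : F.Fits N) {u w u' w' : V} (ha : F.adj u w)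
    (ha' : F.adj u' w') (hne : (u, w) ≠ (u', w')) {s : ℝ}
    (h1 : F.height N u ≤ s) (h2 : s ≤ F.height N w) (h1' : F.height N u' ≤ s)
    (h2' : s ≤ F.height N w') (he : F.edgeCoord N u w s = F.edgeCoord N u' w' s) :
    ∃ v, s = F.height N v ∧ F.edgeCoord N u w s = F.coord N (F.height N v) (v, v) := by
  have s0 : 0 ≤ s := le_trans (by exact_mod_cast (hF.height_mem u).1) h1
  have s1 : s ≤ N := le_trans h2 (by exact_mod_cast (hF.height_mem w).2)
  unfold edgeCoord at *
  rcases exists_int_or_between s0 s1 with ⟨k, rfl, k0, k1⟩ | ⟨k, hk, hk', k0, k1⟩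
  · rw [interp_int _ k0 k1] at he ⊢
    rw [interp_int _ k0 k1] at he
    norm_cast at h1 h2 h1' h2'
    have ho := (hF.isCoord k0 k1).inj (objectAt_mem ha h1 h2) (objectAt_mem ha' h1' h2') he
    have hv : ∃ v, F.objectAt N u w k = (v, v) ∧ F.height N v = k := by
      by_cases e1 : F.height N u = k
      · exact ⟨u, if_pos e1, e1⟩
      by_cases e2 : F.height N w = k
      · exact ⟨w, by rw [objectAt, if_neg e1, if_pos e2], e2⟩
      by_cases e1' : F.height N u' = k
      · exact ⟨u', by rw [ho, objectAt, if_pos e1'], e1'⟩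
      by_cases e2' : F.height N w' = k
      · exact ⟨w', by rw [ho, objectAt, if_neg e1', if_pos e2'], e2'⟩
      · rw [objectAt, objectAt, if_neg e1, if_neg e2, if_neg e1', if_neg e2'] at ho
        exact absurd ho hne
    obtain ⟨v, hv, rfl⟩ := hv
    exact ⟨v, rfl, by rw [hv]⟩
  · exfalso
    rw [interp_between _ k0 k1 hk.le hk'.le, interp_between _ k0 k1 hk.le hk'.le] at he
    have lo : ∀ v, (F.height N v : ℝ) ≤ s → F.height N v ≤ k := by
      intro v hv
      have : (F.height N v : ℝ) < k + 1 := lt_of_le_of_lt hv hk'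
      have : F.height N v < k + 1 := by exact_mod_cast this
      omega
    have hi : ∀ v, s ≤ (F.height N v : ℝ) → k + 1 ≤ F.height N v := by
      intro v hv
      have : (k : ℝ) < F.height N v := lt_of_lt_of_le hk hv
      have : k < F.height N v := by exact_mod_cast this
      omega
    have c1 := hF.isCoord k0 (by omega : k ≤ N)
    have c2 := hF.isCoord (by omega : 0 ≤ k + 1) k1
    have l := lo u h1
    have l' := lo u' h1'
    have g := hi w h2
    have g' := hi w' h2'
    have m1 := objectAt_mem (N := N) ha l (by omega)
    have m1' := objectAt_mem (N := N) ha' l' (by omega)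
    have m2 := objectAt_mem (N := N) (h := k + 1) ha (by omega) g
    have m2' := objectAt_mem (N := N) (h := k + 1) ha' (by omega) g'
    rcases lt_trichotomy (F.coord N k (F.objectAt N u w k)) (F.coord N k (F.objectAt N u' w' k))
      with t | t | t
    · have t2 : F.coord N (k + 1) (F.objectAt N u' w' (k + 1)) <
          F.coord N (k + 1) (F.objectAt N u w (k + 1)) := by
        by_contra t2
        nlinarith [mul_pos (sub_pos.2 hk') (sub_pos.2 t)]
      exact hF.consistent ha ha' l l' (by omega) (by omega)
        (above_of_low (by omega) (by omega) ((c1.of_lt m1 m1' t).1 (by omega)))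
        (below_of_high (by omega) (by omega) ((c2.of_lt m2' m2 t2).2 (by omega)))
    · have t2 : F.coord N (k + 1) (F.objectAt N u w (k + 1)) =
          F.coord N (k + 1) (F.objectAt N u' w' (k + 1)) := by
        rw [t] at he
        exact mul_left_cancel₀ (sub_pos.2 hk).ne' (add_left_cancel he)
      have e1 := c1.inj m1 m1' t
      have e2 := c2.inj m2 m2' t2
      apply hne
      -- The object on the lower level has the tail of the edge as first component; the one on the
      -- upper level has its head as second component.
      have hu : u = u' := by
        rcases objectAt_low (F := F) (N := N) (u := u) (w := w) (h := k) (by omega) with ⟨e, _⟩ | ⟨e, _⟩ <;>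
          rcases objectAt_low (F := F) (N := N) (u := u') (w := w') (h := k) (by omega) with ⟨e', _⟩ | ⟨e', _⟩ <;>
          rw [e, e'] at e1 <;> exact congrArg Prod.fst e1
      have hw : w = w' := by
        rcases objectAt_high (F := F) (N := N) (u := u) (w := w) (h := k + 1) (by omega) with ⟨e, _⟩ | ⟨e, _⟩ <;>
          rcases objectAt_high (F := F) (N := N) (u := u') (w := w') (h := k + 1) (by omega) with ⟨e', _⟩ | ⟨e', _⟩ <;>
          rw [e, e'] at e2 <;> exact congrArg Prod.snd e2
      rw [hu, hw]
    · have t2 : F.coord N (k + 1) (F.objectAt N u w (k + 1)) <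
          F.coord N (k + 1) (F.objectAt N u' w' (k + 1)) := by
        by_contra t2
        nlinarith [mul_pos (sub_pos.2 hk') (sub_pos.2 t)]
      exact hF.consistent ha' ha l' l (by omega) (by omega)
        (above_of_low (by omega) (by omega) ((c1.of_lt m1' m1 t).1 (by omega)))
        (below_of_high (by omega) (by omega) ((c2.of_lt m2 m2' t2).2 (by omega)))

variable (F N) in
/-- The height of the point with parameter `t` on the edge `u → w`. -/
noncomputable def edgeHeight (u w : V) (t : ℝ) : ℝ :=
  F.height N u + t * (F.height N w - F.height N u)

theorem Fits.edgeHeight_mem (hF : F.Fits N) {u w : V} (ha : F.adj u w) (t : unitInterval) :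
    (F.height N u : ℝ) ≤ F.edgeHeight N u w t ∧ F.edgeHeight N u w t ≤ F.height N w := by
  have h : (F.height N u : ℝ) < F.height N w := by exact_mod_cast hF.height_lt ha
  have t0 := t.2.1
  have t1 := t.2.2
  unfold edgeHeight
  constructor <;> nlinarith

theorem Fits.edgeHeight_inj (hF : F.Fits N) {u w : V} (ha : F.adj u w) {s t : ℝ}
    (h : F.edgeHeight N u w s = F.edgeHeight N u w t) : s = t := by
  have hlt : (F.height N u : ℝ) < F.height N w := by exact_mod_cast hF.height_lt ha
  exact mul_right_cancel₀ (sub_pos.2 hlt).ne' (add_left_cancel h)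

variable (F N) in
/-- The point of a vertex in the drawing. -/
noncomputable def vertexPoint (v : V) : ℂ :=
  squarePoint N (F.coord N (F.height N v) (v, v)) (F.height N v)

variable (F N) in
/-- The point with parameter `t` on the edge `u → w` in the drawing. -/
noncomputable def edgePoint (u w : V) (t : ℝ) : ℂ :=
  squarePoint N (F.edgeCoord N u w (F.edgeHeight N u w t)) (F.edgeHeight N u w t)

theorem continuous_edgePoint (u w : V) : Continuous (F.edgePoint N u w) := by
  have h1 : Continuous (F.edgeHeight N u w) := by unfold edgeHeight; fun_prop
  have h2 : Continuous (F.edgeCoord N u w) := continuous_interp _ _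
  have h3 : Continuous fun t : ℝ => F.edgeCoord N u w (F.edgeHeight N u w t) := h2.comp h1
  have e : F.edgePoint N u w = fun t =>
      ((√2 / 2 * F.edgeCoord N u w (F.edgeHeight N u w t) : ℝ) : ℂ) +
      ((√2 / 2 * (2 * F.edgeHeight N u w t / N - 1) : ℝ) : ℂ) * Complex.I := by
    funext t
    exact Complex.mk_eq_add_mul_I _ _
  rw [e]
  fun_prop

theorem Fits.edge_bounds (hF : F.Fits N) {u w : V} (ha : F.adj u w) (t : unitInterval) :
    0 ≤ F.edgeHeight N u w t ∧ F.edgeHeight N u w t ≤ N := by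
  have h := hF.edgeHeight_mem ha t
  have h1 : (0 : ℝ) ≤ F.height N u := by exact_mod_cast (hF.height_mem u).1
  have h2 : (F.height N w : ℝ) ≤ N := by exact_mod_cast (hF.height_mem w).2
  constructor <;> linarith

theorem edgePoint_eq_vertexPoint [Finite V] (hF : F.Fits N) {u w v : V} {t : ℝ}
    (h : F.edgeHeight N u w t = F.height N v)
    (h' : F.objectAt N u w (F.height N v) = (v, v)) :
    F.edgePoint N u w t = F.vertexPoint N v := by
  have hv := hF.height_mem v
  rw [edgePoint, vertexPoint, h, edgeCoord, interp_int _ hv.1 hv.2, h']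

/-- The drawing given by the left-to-right orders of all levels. -/
noncomputable def Fits.drawing [Finite V] (hF : F.Fits N) :
    DiscDrawing (Digraph.mk F.adj) where
  pos := F.vertexPoint N
  arc := fun u w => ⟨fun t => F.edgePoint N u w t,
    (continuous_edgePoint u w).comp continuous_subtype_val⟩
  pos_mem := fun v => by
    have h := hF.height_mem v
    exact squarePoint_mem hF.pos ((hF.isCoord h.1 h.2).abs_le _) (by exact_mod_cast h.1)
      (by exact_mod_cast h.2)
  pos_injective := fun v v' h => by
    have h1 := squarePoint_inj hF.pos h
    have h2 : F.height N v = F.height N v' := by exact_mod_cast h1.2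
    have h3 := h1.1
    rw [← h2] at h3
    have hv := hF.height_mem v
    exact congrArg Prod.fst ((hF.isCoord hv.1 hv.2).inj (o := (v, v)) (o' := (v', v'))
      (Or.inr ⟨rfl, rfl⟩) (Or.inr ⟨rfl, h2.symm⟩) h3)
  arc_mem := fun u w ha t => by
    have h := hF.edge_bounds ha t
    exact squarePoint_mem hF.pos (hF.abs_edgeCoord_le u w h.1 h.2) h.1 h.2
  arc_zero := fun u w ha =>
    edgePoint_eq_vertexPoint hF (by simp [edgeHeight]) (by simp [objectAt])
  arc_one := fun u w ha =>
    edgePoint_eq_vertexPoint hF (by simp [edgeHeight])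
      (by simp [objectAt, (hF.height_lt ha).ne])
  arc_injective := fun u w ha s t h =>
    Subtype.ext (hF.edgeHeight_inj ha (squarePoint_inj hF.pos h).2)
  arc_vertex := fun u w ha t v h => by
    have h1 := squarePoint_inj hF.pos h
    have hm := hF.edgeHeight_mem ha t
    rw [h1.2] at hm h1
    exact hF.vertex_on_edge ha (by exact_mod_cast hm.1) (by exact_mod_cast hm.2) h1.1
  arc_inter := fun u w u' w' ha ha' hne s t h => by
    have h1 := squarePoint_inj hF.pos h
    have hm := hF.edgeHeight_mem ha s
    have hm' := hF.edgeHeight_mem ha' t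
    rw [← h1.2] at hm' h1
    obtain ⟨v, hv, hv'⟩ := hF.edges_meet ha ha' hne hm.1 hm.2 hm'.1 hm'.2 h1.1
    refine ⟨v, ?_⟩
    change F.edgePoint N u w s = F.vertexPoint N v
    rw [edgePoint, vertexPoint, hv', hv]

theorem Fits.drawnInDiscInOrder [Finite V] (hF : F.Fits N) :
    (Digraph.mk F.adj).DrawnInDiscInOrder F.a F.b F.c F.d := by
  refine ⟨hF.drawing, ?_⟩
  change InOrderOnCircle (F.vertexPoint N F.a) (F.vertexPoint N F.b) (F.vertexPoint N F.c)
    (F.vertexPoint N F.d)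
  simp only [vertexPoint, height_src (F := F) (N := N) (Or.inl rfl : F.Src F.a),
    height_src (F := F) (N := N) (Or.inr rfl : F.Src F.b),
    height_snk (F := F) (N := N) (Or.inl rfl : F.Snk F.c),
    height_snk (F := F) (N := N) (Or.inr rfl : F.Snk F.d), coord_a, coord_b, hF.coord_c,
    hF.coord_d, Int.cast_zero]
  exact squarePoint_inOrder hF.pos

end Frame
end Digraph

/-! ### Dipaths, topological numbering, and dipaths from token walks -/

namespace Digraph

variable {V : Type*}

theorem isDipath_singleton (G : Digraph V) (v : V) : G.IsDipath v v [v] :=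
  ⟨List.isChain_singleton v, List.nodup_singleton v, rfl, rfl⟩

theorem IsDipath.snoc {G : Digraph V} {u v w : V} {l : List V} (h : G.IsDipath u v l)
    (ha : G.Adj v w) (hw : w ∉ l) : G.IsDipath u w (l ++ [w]) := by
  refine ⟨?_, ?_, ?_, by simp⟩
  · rw [List.isChain_append]
    refine ⟨h.chain, List.isChain_singleton w, ?_⟩
    intro x hx y hy
    rw [h.last_eq, Option.mem_some_iff] at hx
    rw [List.head?_cons, Option.mem_some_iff] at hy
    rwa [← hx, ← hy]
  · rw [List.nodup_append]
    refine ⟨h.nodup, List.nodup_singleton w, ?_⟩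
    rintro x hx y hy rfl
    exact hw (List.mem_singleton.1 hy ▸ hx)
  · simp [List.head?_append, h.head_eq]

/-- The part of the dipath from `w` onwards would be closed to a dicycle by the edge `v → w`. -/
theorem IsDipath.notMem_of_adj {G : Digraph V} (hG : G.IsAcyclic) {u v w : V} {l : List V}
    (h : G.IsDipath u v l) (ha : G.Adj v w) : w ∉ l := by
  intro hw
  obtain ⟨s, t, rfl⟩ := List.append_of_mem hw
  refine hG (w :: t) ⟨w, v, ⟨?_, ?_, rfl, ?_⟩, ha⟩
  · exact (List.isChain_append.1 h.chain).2.1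
  · exact (List.nodup_append.1 h.nodup).2.1
  · simpa using h.last_eq

/-- The rank of a vertex is the number of vertices in a longest dipath ending there. -/
theorem IsAcyclic.exists_rank [Fintype V] {G : Digraph V} (hG : G.IsAcyclic) :
    ∃ f : V → ℕ, (∀ v, f v ≤ Fintype.card V) ∧ ∀ u v, G.Adj u v → f u < f v := by
  let S : V → Set ℕ := fun v => {n | ∃ u l, G.IsDipath u v l ∧ l.length = n}
  have hb : ∀ v, ∀ n ∈ S v, n ≤ Fintype.card V := by
    rintro v n ⟨u, l, h, rfl⟩
    exact h.nodup.length_le_card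
  have hne : ∀ v, (S v).Nonempty := fun v => ⟨1, v, [v], G.isDipath_singleton v, rfl⟩
  have hbdd : ∀ v, BddAbove (S v) := fun v => ⟨_, hb v⟩
  refine ⟨fun v => sSup (S v), fun v => hb v _ (Nat.sSup_mem (hne v) (hbdd v)), ?_⟩
  intro u v ha
  obtain ⟨x, l, hl, hlen⟩ := Nat.sSup_mem (hne u) (hbdd u)
  have : l.length + 1 ∈ S v := ⟨x, l ++ [v], hl.snoc ha (hl.notMem_of_adj hG ha), by simp⟩
  have := le_csSup (hbdd v) this
  change sSup (S u) < sSup (S v)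
  omega

/-- An injective numbering along the edges that starts with `a, b` and ends with `c, d`. -/
theorem IsAcyclic.exists_ord [Finite V] {G : Digraph V} (hG : G.IsAcyclic) {a b c d : V}
    (hab : a ≠ b) (hcd : c ≠ d) (hST : ∀ v, (v = a ∨ v = b) → ¬ (v = c ∨ v = d))
    (hin : ∀ u v, G.Adj u v → ¬ (v = a ∨ v = b)) (hout : ∀ u v, G.Adj u v → ¬ (u = c ∨ u = d)) :
    ∃ (ord : V → ℤ) (N : ℤ), 0 < N ∧ ord.Injective ∧ (∀ u v, G.Adj u v → ord u < ord v) ∧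
      (∀ v, (v = a ∨ v = b) → -1 ≤ ord v ∧ ord v ≤ 0) ∧
      (∀ v, (v = c ∨ v = d) → N ≤ ord v ∧ ord v ≤ N + 1) ∧
      (∀ v, ¬ (v = a ∨ v = b) → ¬ (v = c ∨ v = d) → 0 < ord v ∧ ord v < N) := by
  classical
  have := Fintype.ofFinite V
  obtain ⟨f, hf, hfa⟩ := hG.exists_rank
  set n := Fintype.card V with hn
  let e : V ≃ Fin n := Fintype.equivFin V
  -- Lexicographic order on rank and index, to make the rank injective.
  let g : V → ℕ := fun v => f v * n + e v
  have hg : ∀ v, g v < (n + 1) * n := by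
    intro v
    have h1 := Nat.mul_le_mul_right n (hf v)
    have h2 := (e v).2
    simp only [g]
    rw [add_mul, one_mul]
    omega
  have hgi : ∀ u v, g u = g v → u = v := by
    intro u v h
    have h1 := congrArg (· % n) h
    simp only [g, Nat.mul_add_mod_self_right, Nat.mod_eq_of_lt (e u).2,
      Nat.mod_eq_of_lt (e v).2] at h1
    exact e.injective (Fin.ext h1)
  have hga : ∀ u v, G.Adj u v → g u < g v := by
    intro u v h
    have h1 := Nat.mul_le_mul_right n (hfa u v h)
    have h2 := (e u).2
    simp only [g, Nat.succ_eq_add_one] at *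
    rw [add_mul, one_mul] at h1
    omega
  let N : ℤ := 1 + ((n + 1) * n : ℕ)
  let ord : V → ℤ := fun v => if v = a then -1 else if v = b then 0 else if v = c then N else
    if v = d then N + 1 else 1 + g v
  have hN : 0 < N := by simp only [N]; omega
  have oa : ord a = -1 := by simp [ord]
  have ob : ord b = 0 := by simp [ord, hab.symm]
  have nca : c ≠ a := fun h => hST c (Or.inl h) (Or.inl rfl)
  have ncb : c ≠ b := fun h => hST c (Or.inr h) (Or.inl rfl)
  have nda : d ≠ a := fun h => hST d (Or.inl h) (Or.inr rfl)
  have ndb : d ≠ b := fun h => hST d (Or.inr h) (Or.inr rfl)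
  have oc : ord c = N := by simp [ord, nca, ncb]
  have od : ord d = N + 1 := by simp [ord, nda, ndb, hcd.symm]
  have oi : ∀ v, ¬ (v = a ∨ v = b) → ¬ (v = c ∨ v = d) → ord v = 1 + g v := by
    intro v h h'
    push Not at h h'
    simp [ord, h.1, h.2, h'.1, h'.2]
  have bi : ∀ v, ¬ (v = a ∨ v = b) → ¬ (v = c ∨ v = d) → 0 < ord v ∧ ord v < N := by
    intro v h h'
    have := hg v
    rw [oi v h h']
    simp only [N]
    omega
  have bs : ∀ v, (v = a ∨ v = b) → -1 ≤ ord v ∧ ord v ≤ 0 := by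
    rintro v (rfl | rfl) <;> omega
  have bt : ∀ v, (v = c ∨ v = d) → N ≤ ord v ∧ ord v ≤ N + 1 := by
    rintro v (rfl | rfl) <;> omega
  refine ⟨ord, N, hN, ?_, ?_, bs, bt, bi⟩
  · intro u v h
    by_cases hu : u = a ∨ u = b
    · by_cases hv : v = a ∨ v = b
      · rcases hu with rfl | rfl <;> rcases hv with rfl | rfl <;> first | rfl | omega
      · have h1 := bs u hu
        by_cases hv' : v = c ∨ v = d
        · have := bt v hv'; omega
        · have := bi v hv hv'; omega
    · by_cases hu' : u = c ∨ u = d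
      · by_cases hv' : v = c ∨ v = d
        · rcases hu' with rfl | rfl <;> rcases hv' with rfl | rfl <;> first | rfl | omega
        · have h1 := bt u hu'
          by_cases hv : v = a ∨ v = b
          · have := bs v hv; omega
          · have := bi v hv hv'; omega
      · have h1 := bi u hu hu'
        by_cases hv : v = a ∨ v = b
        · have := bs v hv; omega
        by_cases hv' : v = c ∨ v = d
        · have := bt v hv'; omega
        · rw [oi u hu hu', oi v hv hv'] at h
          exact hgi u v (by omega)
  · intro u v h
    have hv := hin u v h
    have hu' := hout u v h
    by_cases hu : u = a ∨ u = b
    · have h1 := bs u hu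
      by_cases hv' : v = c ∨ v = d
      · have := bt v hv'; omega
      · have := bi v hv hv'; omega
    · by_cases hv' : v = c ∨ v = d
      · have := bt v hv'
        have := bi u hu hu'; omega
      · rw [oi u hu hu', oi v hv hv']
        have := hga u v h
        omega

/-- The bounds on `P` and `Q` drive the induction: a newly entered vertex is later than both tokens,
hence later than everything visited so far. -/
theorem PairReach.exists_dipaths {G : Digraph V} {ord : V → ℤ} {a b x y : V} (hab : a ≠ b)
    (hord : ∀ u v, G.Adj u v → ord u < ord v) (h : PairReach G.Adj ord a b x y) :
    ∃ P Q : List V, G.IsDipath a x P ∧ G.IsDipath b y Q ∧ P.Disjoint Q ∧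
      (∀ z ∈ P, ord z ≤ ord x) ∧ ∀ z ∈ Q, ord z ≤ ord y := by
  induction h with
  | base =>
    refine ⟨[a], [b], G.isDipath_singleton a, G.isDipath_singleton b, ?_, ?_, ?_⟩
    · simpa [List.Disjoint] using hab
    · simp
    · simp
  | @left x y x' _ ha hlt ih =>
    obtain ⟨P, Q, hP, hQ, hd, bP, bQ⟩ := ih
    have hx := hord _ _ ha
    refine ⟨P ++ [x'], Q, hP.snoc ha fun hm => ?_, hQ, ?_, ?_, bQ⟩
    · have := bP _ hm; omega
    · rw [List.disjoint_append_left]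
      refine ⟨hd, ?_⟩
      rw [List.singleton_disjoint]
      intro hm
      have := bQ _ hm; omega
    · intro z hz
      rcases List.mem_append.1 hz with hz | hz
      · have := bP z hz; omega
      · rw [List.mem_singleton.1 hz]
  | @right x y y' _ ha hlt ih =>
    obtain ⟨P, Q, hP, hQ, hd, bP, bQ⟩ := ih
    have hx := hord _ _ ha
    refine ⟨P, Q ++ [y'], hP, hQ.snoc ha fun hm => ?_, ?_, bP, ?_⟩
    · have := bQ _ hm; omega
    · rw [List.disjoint_append_right]
      refine ⟨hd, ?_⟩
      rw [List.disjoint_singleton]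
      intro hm
      have := bP _ hm; omega
    · intro z hz
      rcases List.mem_append.1 hz with hz | hz
      · have := bQ z hz; omega
      · rw [List.mem_singleton.1 hz]

/-- The backward walk is undone move by move. When a backward token returns from `x'` to `x`, the
forward token below it crosses its piece to `x'` (or is already there), and the edge `x' → x`
becomes the new piece. Concurrency makes each forward move legal. -/
theorem PairReach.link {adj : V → V → Prop} {ord : V → ℤ} {a b c d : V}
    (hcd : ord c ≠ ord d) (hord : ∀ u v, adj u v → ord u < ord v) {w w' : V}
    (h : PairReach (flip adj) (fun v => -ord v) d c w' w) {u u' : V}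
    (hp : IsPiece adj a b c d u w) (hp' : IsPiece adj a b c d u' w')
    (h1 : ord u < ord w') (h2 : ord u' < ord w) (hl : PairReach adj ord a b u u') :
    PairReach adj ord a b c d := by
  induction h generalizing u u' with
  | base =>
    have ha : adj u c := hp.resolve_right fun k => k.2.2 (Or.inl k.1)
    have ha' : adj u' d := hp'.resolve_right fun k => k.2.2 (Or.inr k.1)
    -- The token bound for the earlier sink has to move first.
    rcases lt_or_gt_of_ne hcd with k | k
    · exact (hl.left ha h2).right ha' k
    · exact (hl.right ha' h1).left ha k
  | @left x y x' _ ha hlt ih =>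
    have ha : adj x' x := ha
    have hx := hord _ _ ha
    refine ih hp (Or.inl ha) (by omega) (by omega) ?_
    rcases hp' with k | ⟨rfl, _⟩
    · exact hl.right k h1
    · exact hl
  | @right x y y' _ ha hlt ih =>
    have ha : adj y' y := ha
    have hx := hord _ _ ha
    refine ih (Or.inl ha) hp' (by omega) (by omega) ?_
    rcases hp with k | ⟨rfl, _⟩
    · exact hl.left k h2
    · exact hl

theorem drawnInDiscInOrder_of_not_hasDisjointDipaths [Finite V] (G : Digraph V)
    (hG : G.IsAcyclic) (a b c d : V) (hab : a ≠ b) (hcd : c ≠ d)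
    (hS : G.sources = {a, b}) (hT : G.sinks = {c, d})
    (hST : Disjoint G.sources G.sinks)
    (hdeg : ∀ v : V, v ∉ G.sources ∪ G.sinks → 2 ≤ G.inDeg v ∧ 2 ≤ G.outDeg v)
    (hno : ¬ G.HasDisjointDipaths a b c d) : G.DrawnInDiscInOrder a b c d := by
  have src : ∀ v, v ∈ G.sources ↔ (v = a ∨ v = b) := fun v => by rw [hS]; simp
  have snk : ∀ v, v ∈ G.sinks ↔ (v = c ∨ v = d) := fun v => by rw [hT]; simp
  have h1 : ∀ v, (v = a ∨ v = b) → ¬ (v = c ∨ v = d) := fun v h h' =>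
    Set.disjoint_left.1 hST ((src v).2 h) ((snk v).2 h')
  have h2 : ∀ u v, G.Adj u v → ¬ (v = a ∨ v = b) := fun u v ha h => by
    have : G.inNeighbors v = ∅ := (src v).2 h
    exact Set.eq_empty_iff_forall_notMem.1 this u ha
  have h3 : ∀ u v, G.Adj u v → ¬ (u = c ∨ u = d) := fun u v ha h => by
    have : G.outNeighbors u = ∅ := (snk u).2 h
    exact Set.eq_empty_iff_forall_notMem.1 this v ha
  have h4 : ∀ v, ¬ (v = a ∨ v = b) → ¬ (v = c ∨ v = d) → v ∉ G.sources ∪ G.sinks := by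
    rintro v h h' (k | k)
    · exact h ((src v).1 k)
    · exact h' ((snk v).1 k)
  obtain ⟨ord, N, hN, oinj, oadj, os, ot, oi⟩ := hG.exists_ord hab hcd h1 h2 h3
  let F : Frame V :=
    { adj := G.Adj
      ord := ord
      bound := N + 1
      a := a
      b := b
      c := c
      d := d
      ord_inj := fun u v h => oinj h
      ord_bound := fun v => by
        by_cases h : v = a ∨ v = b
        · have := os v h; omega
        by_cases h' : v = c ∨ v = d
        · have := ot v h'; omega
        · have := oi v h h'; omega
      adj_lt := oadj
      a_ne_b := hab
      c_ne_d := hcd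
      source_sink := h1
      source_lt := fun u v h h' => by
        have := os u h
        by_cases k : v = c ∨ v = d
        · have := ot v k; omega
        · have := oi v h' k; omega
      lt_sink := fun u v h h' => by
        have := ot v h'
        by_cases k : u = a ∨ u = b
        · have := os u k; omega
        · have := oi u k h; omega
      not_adj_source := h2
      not_sink_adj := h3
      in_two := fun v h h' z => by
        obtain ⟨u, hu, hz⟩ := Set.exists_ne_of_one_lt_ncard (hdeg v (h4 v h h')).1 z
        exact ⟨u, hz, hu⟩
      out_two := fun v h h' z => by
        obtain ⟨u, hu, hz⟩ := Set.exists_ne_of_one_lt_ncard (hdeg v (h4 v h h')).2 z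
        exact ⟨u, hz, hu⟩
      noLink := fun u w u' w' hp hp' k k' hl hr => by
        have hreach := hr.link (fun h => hcd (oinj h)) oadj hp hp' k k' hl
        obtain ⟨P, Q, hP, hQ, hPQ, _⟩ := hreach.exists_dipaths hab oadj
        exact hno ⟨P, Q, hP, hQ, hPQ⟩ }
  have hF : F.Fits N := ⟨hN, fun v h h' => oi v h h'⟩
  exact hF.drawnInDiscInOrder

end Digraph

/-! ### Interlacing paths in the disc intersect -/

namespace Digraph

/-- A nowhere vanishing continuous function on the plane has a continuous logarithm. -/
theorem exists_continuous_log {f : ℝ × ℝ → ℂ} (hf : Continuous f) (h0 : ∀ x, f x ≠ 0) :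
    ∃ g : ℝ × ℝ → ℂ, Continuous g ∧ ∀ x, Complex.exp (g x) = f x := by
  let F : C(ℝ × ℝ, {z : ℂ // z ≠ 0}) := ⟨fun x => ⟨f x, h0 x⟩, by fun_prop⟩
  obtain ⟨g, hg, _⟩ := Complex.isCoveringMap_exp.existsUnique_continuousMap_lifts F
    (a₀ := (0, 0)) (e₀ := Complex.log (f (0, 0))) (Subtype.ext (Complex.exp_log (h0 _)))
  refine ⟨g, g.continuous, fun x => ?_⟩
  exact congrArg Subtype.val (congrFun hg.2 x)

theorem eq_of_exp_const {g : ℝ → ℂ} (hg : Continuous g) {c : ℂ}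
    (h : ∀ t, Complex.exp (g t) = c) (s t : ℝ) : g s = g t := by
  have := Complex.isCoveringMap_exp.eq_of_comp_eq hg (continuous_const (y := g t))
    (by funext x; exact Subtype.ext ((h x).trans (h t).symm)) t rfl
  exact congrFun this s

/-- The closed unit disc meets the half-plane of real part at least 1 only in the point 1, so the
difference has positive real part. -/
theorem one_sub_div_mem_slitPlane {p q : ℂ} (hp : ‖p‖ = 1) (hq : ‖q‖ ≤ 1) (hne : q ≠ p) :
    1 - q / p ∈ Complex.slitPlane := by
  have hp0 : p ≠ 0 := by rintro rfl; simp at hp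
  have hz : ‖q / p‖ ≤ 1 := by rw [norm_div, hp, div_one]; exact hq
  have hz1 : q / p ≠ 1 := fun h => hne (by rwa [div_eq_one_iff_eq hp0] at h)
  refine Or.inl ?_
  rw [Complex.sub_re, Complex.one_re, sub_pos]
  refine lt_of_le_of_ne ((Complex.re_le_norm _).trans hz) fun h => hz1 ?_
  have h2 : Complex.normSq (q / p) ≤ 1 := by
    rw [Complex.normSq_eq_norm_sq]
    exact pow_le_one₀ (norm_nonneg _) hz
  rw [Complex.normSq_apply, h] at h2
  apply Complex.ext
  · exact h
  · rw [Complex.one_im]; nlinarith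

/-- By `one_sub_div_mem_slitPlane` the principal logarithm of `1 - q / p` is continuous along the
path, so it differs from `g` by a constant. The factor `ε` covers both `p - q` and `q - p`. -/
theorem log_variation {g q : ℝ → ℂ} (hg : Continuous g) (hq : Continuous q) {p ε : ℂ}
    (hp : ‖p‖ = 1) (hq1 : ∀ t, ‖q t‖ ≤ 1) (hne : ∀ t, q t ≠ p)
    (h : ∀ t, Complex.exp (g t) = ε * (p - q t)) :
    g 1 - g 0 = Complex.log (1 - q 1 / p) - Complex.log (1 - q 0 / p) := by
  have hp0 : p ≠ 0 := by rintro rfl; simp at hp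
  have hs := fun t => one_sub_div_mem_slitPlane hp (hq1 t) (hne t)
  have hc : Continuous fun t => g t - Complex.log (1 - q t / p) :=
    hg.sub ((by fun_prop : Continuous fun t => 1 - q t / p).clog hs)
  have := eq_of_exp_const (c := ε * p) hc (fun t => by
    rw [Complex.exp_sub, h, Complex.exp_log (Complex.slitPlane_ne_zero (hs t)),
      div_eq_iff (Complex.slitPlane_ne_zero (hs t))]
    field_simp) 1 0
  linear_combination this

/-- The polar form of a chord: `1 - exp (2ix) = 2 sin x · exp (i (x - π/2))` with `x` half the angle
difference. -/
theorem one_sub_exp_div (θ φ : ℝ) :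
    1 - Complex.exp (θ * Complex.I) / Complex.exp (φ * Complex.I) =
      ((2 * Real.sin ((θ - φ) / 2) : ℝ) : ℂ) * (Complex.cos (((θ - φ) / 2 - Real.pi / 2 : ℝ)) +
        Complex.sin (((θ - φ) / 2 - Real.pi / 2 : ℝ)) * Complex.I) := by
  have hx : θ - φ = 2 * ((θ - φ) / 2) := by ring
  rw [← Complex.exp_sub, ← sub_mul, ← Complex.ofReal_sub]
  generalize (θ - φ) / 2 = x at hx ⊢
  rw [hx, ← Complex.ofReal_cos, ← Complex.ofReal_sin, Real.cos_sub_pi_div_two,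
    Real.sin_sub_pi_div_two]
  apply Complex.ext
  · rw [Complex.sub_re, Complex.exp_ofReal_mul_I_re]
    simp [Real.cos_two_mul, -Complex.ofReal_sin, -Complex.ofReal_cos]
    nlinarith [Real.sin_sq_add_cos_sq x]
  · rw [Complex.sub_im, Complex.exp_ofReal_mul_I_im]
    simp [Real.sin_two_mul, -Complex.ofReal_sin, -Complex.ofReal_cos]

theorem log_one_sub_exp_im {θ φ : ℝ} (h1 : φ < θ) (h2 : θ < φ + 2 * Real.pi) :
    (Complex.log (1 - Complex.exp (θ * Complex.I) / Complex.exp (φ * Complex.I))).im =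
      (θ - φ) / 2 - Real.pi / 2 := by
  rw [Complex.log_im, one_sub_exp_div]
  have := Real.pi_pos
  exact Complex.arg_mul_cos_add_sin_mul_I
    (mul_pos two_pos (Real.sin_pos_of_pos_of_lt_pi (by linarith) (by linarith)))
    ⟨by linarith, by linarith⟩

theorem log_one_sub_exp_im' {θ φ : ℝ} (h1 : φ < θ) (h2 : θ < φ + 2 * Real.pi) :
    (Complex.log (1 - Complex.exp (φ * Complex.I) / Complex.exp (θ * Complex.I))).im =
      Real.pi / 2 - (θ - φ) / 2 := by
  have := Real.pi_pos
  have e : ∀ x : ℝ, Complex.exp (((x + 2 * Real.pi : ℝ) : ℂ) * Complex.I) =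
      Complex.exp (x * Complex.I) := by
    intro x
    push_cast
    rw [add_mul, Complex.exp_add, Complex.exp_two_pi_mul_I, mul_one]
  rw [← e φ, log_one_sub_exp_im (by linarith) (by linarith)]
  ring

/-- Two paths in the unit disc that join interlacing pairs of points of the circle intersect. -/
theorem exists_path_inter {p₁ p₂ p₃ p₄ : ℂ} (h : InOrderOnCircle p₁ p₂ p₃ p₄)
    (P : Path p₁ p₃) (Q : Path p₂ p₄) (hP : ∀ t, ‖P t‖ ≤ 1) (hQ : ∀ t, ‖Q t‖ ≤ 1) :
    ∃ s t, P s = Q t := by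
  by_contra! hne
  obtain ⟨α, β, γ, δ, h12, h23, h34, h41, e1, e2, e3, e4⟩ := h
  have hP' : ∀ t, ‖P.extend t‖ ≤ 1 := fun t => hP _
  have hQ' : ∀ t, ‖Q.extend t‖ ≤ 1 := fun t => hQ _
  have hne' : ∀ s t, P.extend s ≠ Q.extend t := fun s t => hne _ _
  have P0 := P.extend_zero
  have P1 := P.extend_one
  have Q0 := Q.extend_zero
  have Q1 := Q.extend_one
  have cP := P.continuous_extend
  have cQ := Q.continuous_extend
  have nrm : ∀ θ : ℝ, ‖Complex.exp (θ * Complex.I)‖ = 1 := Complex.norm_exp_ofReal_mul_I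
  -- If the paths are disjoint, their difference has a continuous logarithm. On each side of the
  -- parameter square one path stays at a boundary point, so `log_variation` gives the change of `g`
  -- from the four endpoints.
  obtain ⟨g, hg, hg'⟩ := exists_continuous_log (f := fun x => P.extend x.1 - Q.extend x.2)
    (by fun_prop) fun x => sub_ne_zero.2 (hne' _ _)
  have v1 := log_variation (g := fun t => g (0, t)) (q := Q.extend) (p := p₁) (ε := 1)
    (by fun_prop) cQ (by rw [e1]; exact nrm _) hQ' (fun t => by rw [← P0]; exact (hne' 0 t).symm)
    (fun t => by rw [hg', P0, one_mul])
  have v2 := log_variation (g := fun t => g (1, t)) (q := Q.extend) (p := p₃) (ε := 1)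
    (by fun_prop) cQ (by rw [e3]; exact nrm _) hQ' (fun t => by rw [← P1]; exact (hne' 1 t).symm)
    (fun t => by rw [hg', P1, one_mul])
  have v3 := log_variation (g := fun t => g (t, 0)) (q := P.extend) (p := p₂) (ε := -1)
    (by fun_prop) cP (by rw [e2]; exact nrm _) hP' (fun t => by rw [← Q0]; exact hne' t 0)
    (fun t => by rw [hg', Q0]; ring)
  have v4 := log_variation (g := fun t => g (t, 1)) (q := P.extend) (p := p₄) (ε := -1)
    (by fun_prop) cP (by rw [e4]; exact nrm _) hP' (fun t => by rw [← Q1]; exact hne' t 1)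
    (fun t => by rw [hg', Q1]; ring)
  rw [Q0, Q1, e1, e2, e4] at v1
  rw [Q0, Q1, e2, e3, e4] at v2
  rw [P0, P1, e1, e2, e3] at v3
  rw [P0, P1, e1, e3, e4] at v4
  have w1 := congrArg Complex.im v1
  have w2 := congrArg Complex.im v2
  have w3 := congrArg Complex.im v3
  have w4 := congrArg Complex.im v4
  simp only [Complex.sub_im] at w1 w2 w3 w4
  rw [log_one_sub_exp_im (by linarith) (by linarith),
    log_one_sub_exp_im (by linarith) (by linarith)] at w1
  rw [log_one_sub_exp_im (by linarith) (by linarith),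
    log_one_sub_exp_im' (by linarith) (by linarith)] at w2
  rw [log_one_sub_exp_im (by linarith) (by linarith),
    log_one_sub_exp_im' (by linarith) (by linarith)] at w3
  rw [log_one_sub_exp_im' (by linarith) (by linarith),
    log_one_sub_exp_im' (by linarith) (by linarith)] at w4
  have := Real.pi_pos
  -- The changes of the imaginary part along the two routes from `(0, 0)` to `(1, 1)` differ by 2π,
  -- although both equal that of `g (1, 1) - g (0, 0)`.
  linarith

/-! ### A drawing excludes disjoint dipaths -/

variable {V : Type*} {G : Digraph V}

/-- The points of the drawing on the vertices in `l` and the edges between them. -/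
def DiscDrawing.support (D : G.DiscDrawing) (l : List V) : Set ℂ :=
  {z | (∃ v ∈ l, z = D.pos v) ∨ ∃ u ∈ l, ∃ v ∈ l, G.Adj u v ∧ ∃ t, z = D.arc u v t}

theorem DiscDrawing.norm_le_of_mem_support (D : G.DiscDrawing) {l : List V} {z : ℂ}
    (hz : z ∈ D.support l) : ‖z‖ ≤ 1 := by
  rw [← mem_closedBall_zero_iff]
  rcases hz with ⟨v, _, rfl⟩ | ⟨u, _, v, _, ha, t, rfl⟩
  · exact D.pos_mem v
  · exact D.arc_mem u v ha t

/-- Any common point is the point of a vertex, which must then be an end of each arc through it and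
so belong to both lists. -/
theorem DiscDrawing.disjoint_support (D : G.DiscDrawing) {l l' : List V} (h : l.Disjoint l') :
    Disjoint (D.support l) (D.support l') := by
  rw [Set.disjoint_left]
  rintro z (⟨v, hv, rfl⟩ | ⟨u, hu, v, hv, ha, t, rfl⟩)
    (⟨v', hv', hz⟩ | ⟨u', hu', v', hv', ha', t', hz⟩)
  · rw [D.pos_injective hz] at hv
    exact h hv hv'
  · rcases D.arc_vertex u' v' ha' t' v hz.symm with rfl | rfl
    · exact h hv hu'
    · exact h hv hv'
  · rcases D.arc_vertex u v ha t v' hz with rfl | rfl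
    · exact h hu hv'
    · exact h hv hv'
  · have hne : (u, v) ≠ (u', v') := by
      intro k
      obtain ⟨rfl, rfl⟩ := Prod.mk.inj k
      exact h hu hu'
    obtain ⟨w, hw⟩ := D.arc_inter u v u' v' ha ha' hne t t' hz
    have k : w ∈ l := by
      rcases D.arc_vertex u v ha t w hw with rfl | rfl <;> assumption
    have k' : w ∈ l' := by
      rcases D.arc_vertex u' v' ha' t' w (hz ▸ hw) with rfl | rfl <;> assumption
    exact h k k'

/-- The ambient list `l₀` stays fixed while the induction shortens `l`, so all arcs remain in one
support. -/
theorem DiscDrawing.joinedIn_support (D : G.DiscDrawing) {l₀ l : List V} {u v : V}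
    (hl : l ⊆ l₀) (hc : l.IsChain G.Adj) (hu : l.head? = some u) (hv : l.getLast? = some v) :
    JoinedIn (D.support l₀) (D.pos u) (D.pos v) := by
  induction l generalizing u with
  | nil => simp at hu
  | cons x l ih =>
    obtain rfl : x = u := by simpa using hu
    have hx : x ∈ l₀ := hl List.mem_cons_self
    cases l with
    | nil =>
      obtain rfl : x = v := by simpa using hv
      exact JoinedIn.refl (Or.inl ⟨x, hx, rfl⟩)
    | cons y l =>
      rw [List.isChain_cons_cons] at hc
      have hy : y ∈ l₀ := hl (List.mem_cons_of_mem _ List.mem_cons_self)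
      have h1 : JoinedIn (D.support l₀) (D.pos x) (D.pos y) :=
        ⟨⟨D.arc x y, D.arc_zero x y hc.1, D.arc_one x y hc.1⟩,
          fun t => Or.inr ⟨x, hx, y, hy, hc.1, t, rfl⟩⟩
      exact h1.trans (ih (fun z hz => hl (List.mem_cons_of_mem _ hz)) hc.2 rfl
        (by simpa using hv))

theorem DrawnInDiscInOrder.not_hasDisjointDipaths {a b c d : V}
    (h : G.DrawnInDiscInOrder a b c d) : ¬ G.HasDisjointDipaths a b c d := by
  rintro ⟨P, Q, hP, hQ, hPQ⟩
  obtain ⟨D, hD⟩ := h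
  obtain ⟨p, hp⟩ := D.joinedIn_support (List.Subset.refl P) hP.chain hP.head_eq hP.last_eq
  obtain ⟨q, hq⟩ := D.joinedIn_support (List.Subset.refl Q) hQ.chain hQ.head_eq hQ.last_eq
  obtain ⟨s, t, hst⟩ := exists_path_inter hD p q (fun t => D.norm_le_of_mem_support (hp t))
    fun t => D.norm_le_of_mem_support (hq t)
  exact Set.disjoint_left.1 (D.disjoint_support hPQ) (hp s) (hst ▸ hq t)

end Digraph

theorem theorem1 {V : Type*} [Finite V] (G : Digraph V) (hG : G.IsAcyclic)
    (a b c d : V) (hab : a ≠ b) (hcd : c ≠ d)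
    (hS : G.sources = {a, b}) (hT : G.sinks = {c, d})
    (hST : Disjoint G.sources G.sinks)
    (hdeg : ∀ v : V, v ∉ G.sources ∪ G.sinks → 2 ≤ G.inDeg v ∧ 2 ≤ G.outDeg v) :
    (G.HasDisjointDipaths a b c d ∨ G.DrawnInDiscInOrder a b c d) ∧
      ¬ (G.HasDisjointDipaths a b c d ∧ G.DrawnInDiscInOrder a b c d) := by
  refine ⟨?_, fun h => h.2.not_hasDisjointDipaths h.1⟩
  by_cases h : G.HasDisjointDipaths a b c d
  · exact Or.inl h
  · exact Or.inr (G.drawnInDiscInOrder_of_not_hasDisjointDipaths hG a b c d hab hcd hS hT hST hdeg h)
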